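/- For $a\in\mathbb C$ put $k^{a}(n)=\frac{a(a+1)\cdots(a+n-1)}{n!}$ for $n\ge 1$, $k^a(0)=1$. For $\alpha\ge 0$ and a bounded complex sequence $f=(f(n))_{n\ge 0}$ let $$W^\alpha f(n)=\sum_{j=n}^\infty k^{-\alpha}(j-n)f(j),\qquad D^\alpha f(n)=k^{\alpha+1}(n)\,W^\alpha f(n),\qquad n\ge 0 .$$ For $1\le p<\infty$ let $\tau_p^\alpha$ be the space of complex sequences $f$ vanishing at infinity with $\|f\|_{\alpha,p}:=\|D^\alpha f\|_{\ell^p}<\infty$; let $\tau_\infty^\alpha$ be the space of bounded complex sequences $f$ such that $D^\alpha f$ is bounded, with the norm $\|f\|_{\alpha,\infty}:=\max\{\|f\|_{\ell^\infty},\|D^\alpha f\|_{\ell^\infty}\}$. (In particular $\tau_p^0=\ell^p$ for $1\le p\le\infty$.) For $t\ge0$ and $n\ge 0$ let (with $1/\infty=0$) $$T_p(t)f(n)=e^{-t/p}\sum_{j=0}^n\binom nj e^{-tj}(1-e^{-t})^{n-j}f(j),\qquad S_p(t)f(n)=e^{-t(1-\frac1p+n)}\sum_{j=n}^\infty\binom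 jn(1-e^{-t})^{j-n}f(j).$$ Let $\alpha\ge 0$ and $1\le p\le\infty$, and let $A$ and $B$ be the generators of $(T_p(t))_{t\ge0}$ and $(S_p(t))_{t\ge0}$ on $\tau_p^\alpha$. That is, for $f,g\in\tau_p^\alpha$ one has $f\in D(A)$ and $Af=g$ if and only if $T_p(t)f\in\tau_p^\alpha$ for all $t>0$ and $\frac1t(T_p(t)f-f)\to g$ as $t\to0^+$, where the limit is in norm if $p<\infty$, and in the weak-$*$ sense if $p=\infty$ (the quotients are norm bounded for all small $t>0$ and converge to $g$ coordinatewise); likewise for $B$ and $S_p$. Let $\sigma_{point}$ denote the set of eigenvalues, and let $\sigma(B)$ be the set of $\lambda\in\mathbb C$ for which $\lambda-B:D(B)\to\tau_p^\alpha$ is not a bijection with bounded inverse. Write $\mathbb C_-=\{z\in\mathbb C:\operatorname{Re}z<0\}$. Then: (i) (a) $\sigma_{point}(A)=\emptyset$ and $\sigma_{point}(B)=\mathbb C_-$ if $1<p<\infty$; (b) $\sigma_{point}(A)=\emptyset$ and $\sigma_{point}(B)=\mathbb C_-\cup\{0\}$ if $p=1$; (c) $\sigma_{point}(A)=\{0\}$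 and $\sigma_{point}(B)=\mathbb C_-\cup i\mathbb R$ if $p=\infty$. (ii) $\sigma(B)=\mathbb C_-\cup i\mathbb R$ for all $1\le p\le\infty$. -/

import Mathlib

open Filter Topology MeasureTheory
open scoped ENNReal NNReal

namespace SobolevLebesgue

noncomputable section

/-- The Cesaro numbers `k^a(n) = a (a+1) ⋯ (a+n-1) / n!`, with `k^a(0) = 1`, for complex `a`. -/
def cesaroNumber (a : ℂ) (n : ℕ) : ℂ :=
  (∏ i ∈ Finset.range n, (a + (i : ℂ))) / (n.factorial : ℂ)

/-- The Weyl difference `W^α f(n) = ∑_{j ≥ n} k^{-α}(j-n) f(j)` (summed over `j - n`).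
For `α ≥ 0` the series converges absolutely for every bounded `f`. -/
def weylDifference (α : ℝ) (f : ℕ → ℂ) (n : ℕ) : ℂ :=
  ∑' j : ℕ, cesaroNumber (-(α : ℂ)) j * f (n + j)

/-- `D^α f(n) = k^{α+1}(n) W^α f(n)`. -/
def weightedWeyl (α : ℝ) (f : ℕ → ℂ) (n : ℕ) : ℂ :=
  cesaroNumber ((α : ℂ) + 1) n * weylDifference α f n

/-- The norm of `τ_p^α`. For `p < ∞` it is the `ℓ^p` norm of `D^α f`. For `p = ∞` it is the
maximum of the sup norms of `f` and of `D^α f` (when `α > 0`, `D^α` annihilates the constants). -/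
def tauNorm (α : ℝ) (p : ℝ≥0∞) (f : ℕ → ℂ) : ℝ≥0∞ :=
  if p = ∞ then
    max (eLpNorm f ∞ Measure.count) (eLpNorm (weightedWeyl α f) ∞ Measure.count)
  else eLpNorm (weightedWeyl α f) p Measure.count

/-- The space `τ_p^α`: for `p < ∞`, the sequences that vanish at infinity with finite norm;
for `p = ∞`, the bounded sequences `f` such that `D^α f` is bounded. -/
def tau (α : ℝ) (p : ℝ≥0∞) : Set (ℕ → ℂ) :=
  {f | (p ≠ ∞ → Tendsto f atTop (𝓝 0)) ∧ tauNorm α p f < ∞}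

/-- `T_p(t) f(n) = e^{-t/p} ∑_{j=0}^n C(n,j) e^{-tj} (1 - e^{-t})^{n-j} f(j)`, with `1/∞ = 0`. -/
def semigroupT (p : ℝ≥0∞) (t : ℝ) (f : ℕ → ℂ) (n : ℕ) : ℂ :=
  (Real.exp (-(t * (1 / p).toReal)) : ℂ) *
    ∑ j ∈ Finset.range (n + 1),
      ((n.choose j : ℝ) * Real.exp (-(t * j)) * (1 - Real.exp (-t)) ^ (n - j) : ℝ) * f j

/-- `S_p(t) f(n) = e^{-t(1 - 1/p + n)} ∑_{j ≥ n} C(j,n) (1 - e^{-t})^{j-n} f(j)`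
(summed over `j - n`). -/
def semigroupS (p : ℝ≥0∞) (t : ℝ) (f : ℕ → ℂ) (n : ℕ) : ℂ :=
  (Real.exp (-(t * (1 - (1 / p).toReal + n))) : ℂ) *
    ∑' j : ℕ, (((n + j).choose n : ℝ) * (1 - Real.exp (-t)) ^ j : ℝ) * f (n + j)

/-- The difference quotient `(U(t) f - f) / t`. -/
def diffQuotient (U : ℝ → (ℕ → ℂ) → (ℕ → ℂ)) (f : ℕ → ℂ) (t : ℝ) : ℕ → ℂ :=
  (t : ℂ)⁻¹ • (U t f - f)

/-- The graph of the generator on `τ_p^α` of a family `U(t)`, `t ≥ 0`: the pairs `(f, g)` such that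
`(U(t) f - f) / t → g` as `t → 0+`. For `p < ∞` the limit is taken in the norm of `τ_p^α`;
for `p = ∞` it is the weak-* limit, that is, the difference quotients are bounded in norm for
small `t > 0` and converge coordinatewise. -/
def generatorGraph (α : ℝ) (p : ℝ≥0∞) (U : ℝ → (ℕ → ℂ) → (ℕ → ℂ)) :
    Set ((ℕ → ℂ) × (ℕ → ℂ)) :=
  {x | x.1 ∈ tau α p ∧ x.2 ∈ tau α p ∧ (∀ t : ℝ, 0 < t → U t x.1 ∈ tau α p) ∧
    (p ≠ ∞ →
      Tendsto (fun t : ℝ => tauNorm α p (diffQuotient U x.1 t - x.2)) (𝓝[>] 0) (𝓝 0)) ∧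
    (p = ∞ →
      (∃ C : ℝ≥0, ∀ᶠ t : ℝ in 𝓝[>] 0, tauNorm α p (diffQuotient U x.1 t) ≤ C) ∧
      ∀ n : ℕ, Tendsto (fun t : ℝ => diffQuotient U x.1 t n) (𝓝[>] 0) (𝓝 (x.2 n)))}

/-- The (graph of the) generator `A` of `(T_p(t))` on `τ_p^α`. -/
def generatorA (α : ℝ) (p : ℝ≥0∞) : Set ((ℕ → ℂ) × (ℕ → ℂ)) :=
  generatorGraph α p (semigroupT p)

/-- The (graph of the) generator `B` of `(S_p(t))` on `τ_p^α`. -/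
def generatorB (α : ℝ) (p : ℝ≥0∞) : Set ((ℕ → ℂ) × (ℕ → ℂ)) :=
  generatorGraph α p (semigroupS p)

/-- The point spectrum of the operator with graph `G`: its eigenvalues. -/
def pointSpectrum (G : Set ((ℕ → ℂ) × (ℕ → ℂ))) : Set ℂ :=
  {z | ∃ f : ℕ → ℂ, f ≠ 0 ∧ (f, z • f) ∈ G}

/-- The resolvent set on `τ_p^α` of the operator with graph `G`: the `z` such that `z - G` is a
bijection of the domain of `G` onto `τ_p^α` with bounded inverse. -/
def resolventSet (α : ℝ) (p : ℝ≥0∞) (G : Set ((ℕ → ℂ) × (ℕ → ℂ))) : Set ℂ :=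
  {z | (∀ h ∈ tau α p, ∃! f : ℕ → ℂ, (f, z • f - h) ∈ G) ∧
    ∃ C : ℝ≥0, ∀ f g : ℕ → ℂ, (f, g) ∈ G → tauNorm α p f ≤ C * tauNorm α p (z • f - g)}

/-- The spectrum on `τ_p^α` of the operator with graph `G`. -/
def spectrumOn (α : ℝ) (p : ℝ≥0∞) (G : Set ((ℕ → ℂ) × (ℕ → ℂ))) : Set ℂ :=
  (resolventSet α p G)ᶜ

end

end SobolevLebesgue

namespace SobolevLebesgue

/-! Coordinatewise, `B` acts by `genB`: `(Bf)(n) = -(1 - 1/p + n) f(n) + (n + 1) f(n + 1)`. The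
equation `Bf = zf` is thus a first-order recursion whose only solutions are the multiples of
`k^{z+1-1/p}` (`eq_cesaroNumber_of_genB_eq`). By Euler's limit for the Gamma function its modulus is
comparable to `n^{Re z - 1/p}` unless the sequence terminates. Hence it lies in `ℓ^p` exactly for
`Re z < 0` when `1 < p < ∞`, also for `z = 0` (where it is `k^0`, the unit vector at `0`) when `p =
1`, and for `Re z ≤ 0` when `p = ∞`.

The passage from `ℓ^p` to `τ_p^α` rests on the commutation of `D^α` with `S_p(t)`
(`weightedWeyl_semigroupS`), a matrix identity that follows from the Chu-Vandermonde and binomial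
formulas. It makes `D^α` send an eigenvector to a multiple of itself, so
`mem_pointSpectrum_generatorB_iff` no longer depends on `α`.

For `A` the recursion runs upwards: at the first nonzero index `m` it forces `z = -1/p - m`, and the
solution then grows like `n^m`. Boundedness leaves `m = 0`, the constants, which lie in the space
only for `p = ∞`.

If `Re z ≤ 0`, then `z` is a limit of eigenvalues `z - ε` with `Re (z - ε) < 0`, so `z - B` has no
bounded inverse. If `Re z > 0`, the resolvent is built by hand. `S_p(t)` is a contraction of `ℓ^p`,
so `B` is dissipative on finitely supported sequences, where `z - B` is triangular and solvable by
back substitution; a compactness argument on truncations then yields `exists_sub_genB_eq`. For `p <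
∞` the result is carried to `τ_p^α` by the bijection `D^α` with inverse `inverseWeyl`. For `p = ∞`,
where `D^α` may kill constants, the equation is solved for both `h` and `D^α h`, and
`weightedWeyl_eq_of_sub_genB_eq` matches the two solutions. -/

/-! ### Cesaro numbers: identities, generating function, asymptotics -/

theorem cesaroNumber_zero_right (a : ℂ) : cesaroNumber a 0 = 1 := by simp [cesaroNumber]

theorem cesaroNumber_succ (a : ℂ) (n : ℕ) :
    ((n : ℂ) + 1) * cesaroNumber a (n + 1) = (a + n) * cesaroNumber a n := by
  have h : ((n.factorial : ℕ) : ℂ) ≠ 0 := by exact_mod_cast n.factorial_ne_zero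
  have h' : (n : ℂ) + 1 ≠ 0 := by exact_mod_cast n.succ_ne_zero
  simp only [cesaroNumber, Finset.prod_range_succ, Nat.factorial_succ]
  push_cast
  field_simp

theorem cesaroNumber_eq_multichoose (a : ℂ) (n : ℕ) :
    cesaroNumber a n = Ring.multichoose a n := by
  have h : ((n.factorial : ℕ) : ℂ) ≠ 0 := by exact_mod_cast n.factorial_ne_zero
  have h1 := Ring.factorial_nsmul_multichoose_eq_ascPochhammer a n
  have h2 : (ascPochhammer ℂ n).eval a = ∏ i ∈ Finset.range n, (a + (i : ℂ)) := by
    induction n with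
    | zero => simp
    | succ n ih =>
      rw [ascPochhammer_succ_eval, Finset.prod_range_succ, ih]
      · exact_mod_cast n.factorial_ne_zero
      · exact Ring.factorial_nsmul_multichoose_eq_ascPochhammer a n
  rw [Polynomial.ascPochhammer_smeval_eq_eval, h2, nsmul_eq_mul] at h1
  rw [cesaroNumber, div_eq_iff h, ← h1, mul_comm]

theorem cesaroNumber_zero_left (n : ℕ) : cesaroNumber 0 n = if n = 0 then 1 else 0 := by
  cases n with
  | zero => simp [cesaroNumber]
  | succ n => simp [cesaroNumber, Finset.prod_range_succ']

theorem cesaroNumber_one (n : ℕ) : cesaroNumber 1 n = 1 := by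
  rw [cesaroNumber_eq_multichoose, Ring.multichoose_one]

theorem cesaroNumber_eq_neg_one_pow_mul (a : ℂ) (n : ℕ) :
    cesaroNumber a n = (-1) ^ n * Ring.choose (-a) n := by
  rw [cesaroNumber_eq_multichoose, Ring.multichoose_eq, Ring.choose_neg, Units.smul_def]
  simp [← mul_assoc, ← mul_pow]

/-- The Chu-Vandermonde identity for Cesaro numbers. -/
theorem sum_cesaroNumber_mul (a b : ℂ) (n : ℕ) :
    ∑ i ∈ Finset.range (n + 1), cesaroNumber a i * cesaroNumber b (n - i) =
      cesaroNumber (a + b) n := by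
  rw [cesaroNumber_eq_neg_one_pow_mul, neg_add, Ring.add_choose_eq n (Commute.all _ _),
    Finset.Nat.sum_antidiagonal_eq_sum_range_succ_mk, Finset.mul_sum]
  refine Finset.sum_congr rfl fun i hi => ?_
  have hi : i ≤ n := by simpa [Nat.lt_succ_iff] using hi
  rw [cesaroNumber_eq_neg_one_pow_mul, cesaroNumber_eq_neg_one_pow_mul]
  obtain ⟨j, rfl⟩ := Nat.exists_eq_add_of_le hi
  simp only [Nat.add_sub_cancel_left, pow_add]
  ring

/-- Both sides are `a(a+1)⋯(a+n+j-1) / (n! j!)`. This absorbs the binomial weights of `S_p(t)` into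
a shift of the parameter. -/
theorem choose_mul_cesaroNumber_add (a : ℂ) (n j : ℕ) :
    ((n + j).choose n : ℂ) * cesaroNumber a (n + j) =
      cesaroNumber a n * cesaroNumber (a + n) j := by
  have h1 : ((n.factorial : ℕ) : ℂ) ≠ 0 := by exact_mod_cast n.factorial_ne_zero
  have h2 : ((j.factorial : ℕ) : ℂ) ≠ 0 := by exact_mod_cast j.factorial_ne_zero
  have h3 : (((n + j).factorial : ℕ) : ℂ) ≠ 0 := by exact_mod_cast (n + j).factorial_ne_zero
  have h4 : ((n + j).choose n : ℂ) * n.factorial * j.factorial = (n + j).factorial := by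
    rw [Nat.choose_symm_add]
    exact_mod_cast Nat.add_choose_mul_factorial_mul_factorial n j
  simp only [cesaroNumber, Finset.prod_range_add]
  push_cast
  simp only [add_assoc]
  rw [← h4] at h3 ⊢
  have h5 : ((n + j).choose n : ℂ) ≠ 0 := left_ne_zero_of_mul (left_ne_zero_of_mul h3)
  field_simp

theorem hasSum_cesaroNumber_mul_pow (a : ℂ) {x : ℝ} (hx : |x| < 1) :
    HasSum (fun j : ℕ => cesaroNumber a j * (x : ℂ) ^ j) (1 / (1 - (x : ℂ)) ^ a) := by
  have h := Complex.one_div_one_sub_cpow_hasFPowerSeriesOnBall_zero a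
  have hx' : (x : ℂ) ∈ Metric.eball (0 : ℂ) 1 := by
    simpa [Metric.mem_eball, edist_eq_enorm_sub, ← ofReal_norm] using hx
  have := h.hasSum hx'
  rw [zero_add] at this
  refine (congrArg (HasSum · _) (funext fun j => ?_)).mpr this
  simp [cesaroNumber_eq_multichoose, mul_comm,
    Ring.multichoose_eq]

theorem summable_norm_cesaroNumber_mul_pow (a : ℂ) {x : ℝ} (hx : |x| < 1) :
    Summable fun j : ℕ => ‖cesaroNumber a j‖ * |x| ^ j := by
  have := (hasSum_cesaroNumber_mul_pow a (x := |x|) (by simpa using hx)).summable.norm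
  simpa using this

/-- Euler's product for `Γ(a)` read backwards. Its denominator has `n + 1` factors, whence the index
shift; the excluded `a` are the poles of `Γ`, where `k^a` terminates. -/
theorem cesaroNumber_succ_eq_gammaSeq {a : ℂ} (ha : ∀ m : ℕ, a ≠ -m) {n : ℕ} (hn : n ≠ 0) :
    cesaroNumber a (n + 1) = (n : ℂ) ^ a / ((n + 1) * Complex.GammaSeq a n) := by
  have h1 : ((n.factorial : ℕ) : ℂ) ≠ 0 := by exact_mod_cast n.factorial_ne_zero
  have h2 : ∏ j ∈ Finset.range (n + 1), (a + j) ≠ 0 :=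
    Finset.prod_ne_zero_iff.2 fun j _ h => ha j (eq_neg_of_add_eq_zero_left h)
  have h3 : (n : ℂ) + 1 ≠ 0 := by exact_mod_cast n.succ_ne_zero
  have h4 : (n : ℂ) ^ a ≠ 0 := by simp [Complex.cpow_eq_zero_iff, hn]
  simp only [cesaroNumber, Complex.GammaSeq, Nat.factorial_succ]
  push_cast
  field_simp

theorem norm_cesaroNumber_succ_eq {a : ℂ} (ha : ∀ m : ℕ, a ≠ -m) {n : ℕ} (hn : n ≠ 0) :
    ‖cesaroNumber a (n + 1)‖ = (n : ℝ) ^ a.re / ((n + 1) * ‖Complex.GammaSeq a n‖) := by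
  rw [cesaroNumber_succ_eq_gammaSeq ha hn, norm_div, norm_mul,
    Complex.norm_natCast_cpow_of_pos (Nat.pos_of_ne_zero hn)]
  congr 2
  exact_mod_cast Complex.norm_natCast (n + 1)

theorem cesaroNumber_neg_natCast_eq_zero (m : ℕ) {n : ℕ} (h : m < n) :
    cesaroNumber (-(m : ℂ)) n = 0 := by
  rw [cesaroNumber, Finset.prod_eq_zero (Finset.mem_range.2 h) (by ring), zero_div]

theorem tendsto_rpow_div_add_one_div_rpow (s : ℝ) :
    Tendsto (fun n : ℕ => ((n : ℝ) ^ s / (n + 1)) / ((n + 1 : ℕ) : ℝ) ^ (s - 1)) atTop (𝓝 1) := by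
  have h1 : Tendsto (fun n : ℕ => (n : ℝ) / (n + 1)) atTop (𝓝 1) :=
    tendsto_natCast_div_add_atTop (1 : ℝ)
  have h2 := h1.rpow_const (p := s) (Or.inl one_ne_zero)
  rw [Real.one_rpow] at h2
  refine h2.congr fun n => ?_
  have : (0 : ℝ) < n + 1 := by positivity
  rw [Real.div_rpow (by positivity) this.le, Nat.cast_succ, Real.rpow_sub_one this.ne']
  field_simp

/-- `|k^a(n)|` is comparable to `n ^ (Re a - 1)`. -/
theorem tendsto_norm_cesaroNumber_div {a : ℂ} (ha : ∀ m : ℕ, a ≠ -m) :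
    ∃ c : ℝ, 0 < c ∧
      Tendsto (fun n : ℕ => ‖cesaroNumber a n‖ / (n : ℝ) ^ (a.re - 1)) atTop (𝓝 c) := by
  have hG : Complex.Gamma a ≠ 0 := Complex.Gamma_ne_zero ha
  refine ⟨‖Complex.Gamma a‖⁻¹, by positivity, ?_⟩
  rw [← tendsto_add_atTop_iff_nat 1]
  have h1 := ((Complex.GammaSeq_tendsto_Gamma a).norm.inv₀ (norm_ne_zero_iff.2 hG)).mul
    (tendsto_rpow_div_add_one_div_rpow a.re)
  rw [mul_one] at h1
  refine h1.congr' ?_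
  filter_upwards [eventually_ne_atTop 0] with n hn
  rw [norm_cesaroNumber_succ_eq ha hn, ← div_div]
  ring

theorem exists_norm_cesaroNumber_le (a : ℂ) :
    ∃ C : ℝ, 0 ≤ C ∧ ∀ᶠ n : ℕ in atTop, ‖cesaroNumber a n‖ ≤ C * (n : ℝ) ^ (a.re - 1) := by
  by_cases ha : ∀ m : ℕ, a ≠ -m
  · obtain ⟨c, hc, h⟩ := tendsto_norm_cesaroNumber_div ha
    refine ⟨c + 1, by positivity, ?_⟩
    filter_upwards [h.eventually_le_const (show c < c + 1 by linarith), eventually_gt_atTop 0]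
      with n h1 h2
    rwa [div_le_iff₀ (by positivity)] at h1
  · push Not at ha
    obtain ⟨m, rfl⟩ := ha
    refine ⟨0, le_rfl, ?_⟩
    filter_upwards [eventually_gt_atTop m] with n hn
    simp [cesaroNumber_neg_natCast_eq_zero m hn]

theorem exists_le_norm_cesaroNumber {a : ℂ} (ha : ∀ m : ℕ, a ≠ -m) :
    ∃ c : ℝ, 0 < c ∧ ∀ᶠ n : ℕ in atTop, c * (n : ℝ) ^ (a.re - 1) ≤ ‖cesaroNumber a n‖ := by
  obtain ⟨c, hc, h⟩ := tendsto_norm_cesaroNumber_div ha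
  refine ⟨c / 2, by positivity, ?_⟩
  filter_upwards [h.eventually_const_le (show c / 2 < c by linarith), eventually_gt_atTop 0]
    with n h1 h2
  rwa [le_div_iff₀ (by positivity)] at h1

theorem summable_norm_cesaroNumber_rpow {a : ℂ} {q : ℝ} (hq : 0 < q) (h : (a.re - 1) * q < -1) :
    Summable fun n : ℕ => ‖cesaroNumber a n‖ ^ q := by
  obtain ⟨C, hC, hb⟩ := exists_norm_cesaroNumber_le a
  refine Summable.of_norm_bounded_eventually_nat
    ((Real.summable_nat_rpow.2 h).mul_left (C ^ q)) ?_
  filter_upwards [hb] with n hn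
  rw [Real.norm_of_nonneg (by positivity), Real.rpow_mul (by positivity),
    ← Real.mul_rpow hC (by positivity)]
  exact Real.rpow_le_rpow (norm_nonneg _) hn hq.le

theorem summable_norm_cesaroNumber_neg {α : ℝ} (hα : 0 ≤ α) :
    Summable fun n : ℕ => ‖cesaroNumber (-(α : ℂ)) n‖ := by
  rcases hα.eq_or_lt with rfl | h
  -- For `α = 0` the power bound is `n^{-1}`, which is not summable, but the sequence has a single
  -- nonzero term.
  · refine summable_of_ne_finset_zero (s := {0}) fun n hn => ?_
    simp [cesaroNumber_zero_left, Finset.mem_singleton.not.1 hn]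
  · simpa using summable_norm_cesaroNumber_rpow (a := -(α : ℂ)) one_pos (by simp; linarith)

theorem bounded_cesaroNumber {a : ℂ} (ha : a.re ≤ 1) : ∃ C : ℝ, ∀ n, ‖cesaroNumber a n‖ ≤ C := by
  obtain ⟨C, hC, hb⟩ := exists_norm_cesaroNumber_le a
  have h1 : ∀ᶠ n : ℕ in atTop, ‖cesaroNumber a n‖ ≤ C := by
    filter_upwards [hb, eventually_ge_atTop 1] with n hn h1
    refine hn.trans (mul_le_of_le_one_right hC ?_)
    exact Real.rpow_le_one_of_one_le_of_nonpos (by exact_mod_cast h1) (by linarith)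
  obtain ⟨M, hM⟩ := (isBoundedUnder_of_eventually_le h1).bddAbove_range
  exact ⟨M, fun n => hM ⟨n, rfl⟩⟩

/-- The ratio of consecutive terms is `(α + 1 + n) / (n + 1) ≥ 1`. -/
theorem norm_cesaroNumber_add_one_mono {α : ℝ} (hα : 0 ≤ α) :
    Monotone fun n => ‖cesaroNumber ((α : ℂ) + 1) n‖ := by
  refine monotone_nat_of_le_succ fun n => ?_
  have h := congrArg norm (cesaroNumber_succ ((α : ℂ) + 1) n)
  rw [norm_mul, norm_mul] at h
  have h1 : ‖(n : ℂ) + 1‖ = n + 1 := by exact_mod_cast Complex.norm_natCast (n + 1)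
  have h2 : ‖(α : ℂ) + 1 + n‖ = α + 1 + n := by
    rw [← Complex.norm_of_nonneg (show 0 ≤ α + 1 + n by positivity)]; push_cast; rfl
  rw [h1, h2] at h
  have h3 : (0 : ℝ) < n + 1 := by positivity
  have := norm_nonneg (cesaroNumber ((α : ℂ) + 1) n)
  refine le_of_mul_le_mul_left ?_ h3
  rw [h]
  nlinarith

theorem one_le_norm_cesaroNumber_add_one {α : ℝ} (hα : 0 ≤ α) (n : ℕ) :
    1 ≤ ‖cesaroNumber ((α : ℂ) + 1) n‖ := by
  simpa [cesaroNumber_zero_right] using norm_cesaroNumber_add_one_mono hα n.zero_le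

theorem cesaroNumber_add_one_ne_zero {α : ℝ} (hα : 0 ≤ α) (n : ℕ) :
    cesaroNumber ((α : ℂ) + 1) n ≠ 0 :=
  norm_pos_iff.1 (zero_lt_one.trans_le (one_le_norm_cesaroNumber_add_one hα n))

/-! ### Matrices of `W^α` and `S_p(t)` and their products -/

/-- The matrix of the Weyl sum of order `a`, so that `W^α` has matrix `weylKernel (-α)`. -/
noncomputable def weylKernel (a : ℂ) (n m : ℕ) : ℂ :=
  if n ≤ m then cesaroNumber a (m - n) else 0

/-- The matrix of `S_p(t)`, with `c = 1 / p`. -/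
noncomputable def sKernel (c t : ℝ) (n m : ℕ) : ℝ :=
  Real.exp (-(t * (1 - c + n))) * ((m.choose n : ℝ) * (1 - Real.exp (-t)) ^ (m - n))

/-- The operators are upper triangular, so sums over `j - n` become full matrix sums, and
compositions become matrix products. -/
theorem tsum_nat_add_eq_tsum (g : ℕ → ℂ) (n : ℕ) (hg : ∀ m < n, g m = 0) :
    ∑' j, g (n + j) = ∑' m, g m := by
  refine (add_right_injective n).tsum_eq (f := g) fun m hm => ?_
  have : n ≤ m := not_lt.1 fun h => hm (hg m h)
  exact ⟨m - n, Nat.add_sub_cancel' this⟩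

theorem summable_nat_add_iff' {g : ℕ → ℝ} (n : ℕ) :
    Summable (fun j => g (n + j)) ↔ Summable g := by
  rw [← summable_nat_add_iff n (f := g)]
  simp only [add_comm]

theorem weylDifference_eq_tsum (α : ℝ) (f : ℕ → ℂ) (n : ℕ) :
    weylDifference α f n = ∑' m, weylKernel (-α) n m * f m := by
  rw [← tsum_nat_add_eq_tsum _ n fun m hm => by simp [weylKernel, not_le.2 hm]]
  simp [weylDifference, weylKernel]

theorem sKernel_eq_zero {c t : ℝ} {n m : ℕ} (h : m < n) : sKernel c t n m = 0 := by
  simp [sKernel, Nat.choose_eq_zero_of_lt h]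

theorem semigroupS_eq_tsum (p : ℝ≥0∞) (t : ℝ) (f : ℕ → ℂ) (n : ℕ) :
    semigroupS p t f n = ∑' m, (sKernel (1 / p).toReal t n m : ℂ) * f m := by
  rw [← tsum_nat_add_eq_tsum _ n fun m hm => by simp [sKernel_eq_zero hm], semigroupS,
    ← tsum_mul_left]
  refine tsum_congr fun j => ?_
  simp only [sKernel, Nat.add_sub_cancel_left]
  push_cast
  ring

theorem one_sub_exp_neg_mem {t : ℝ} (ht : 0 ≤ t) :
    0 ≤ 1 - Real.exp (-t) ∧ 1 - Real.exp (-t) < 1 := by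
  have := Real.exp_pos (-t)
  have h2 : Real.exp (-t) ≤ 1 := Real.exp_le_one_iff.2 (by linarith)
  constructor <;> linarith

theorem sKernel_nonneg {c t : ℝ} (ht : 0 ≤ t) (n m : ℕ) : 0 ≤ sKernel c t n m := by
  have := (one_sub_exp_neg_mem ht).1
  unfold sKernel
  positivity

theorem norm_sKernel {c t : ℝ} (ht : 0 ≤ t) (n m : ℕ) :
    ‖(sKernel c t n m : ℂ)‖ = sKernel c t n m :=
  Complex.norm_of_nonneg (sKernel_nonneg ht n m)

theorem sKernel_add (c t : ℝ) (n j : ℕ) :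
    sKernel c t n (n + j) = Real.exp (-(t * (1 - c + n))) *
      (((n + j).choose n : ℝ) * (1 - Real.exp (-t)) ^ j) := by
  simp [sKernel]

/-- Row sums, from the series `∑ C(n+j, n) x^j = (1 - x)^{-(n+1)}` at `x = 1 - e^{-t}`. -/
theorem hasSum_sKernel {c t : ℝ} (ht : 0 ≤ t) (n : ℕ) :
    HasSum (sKernel c t n) (Real.exp (t * c)) := by
  obtain ⟨h0, h1⟩ := one_sub_exp_neg_mem ht
  have h := (hasSum_choose_mul_geometric_of_norm_lt_one n
    (r := 1 - Real.exp (-t)) (by rwa [Real.norm_of_nonneg h0])).mul_left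
      (Real.exp (-(t * (1 - c + n))))
  have h2 : HasSum (fun j => sKernel c t n (n + j)) (Real.exp (t * c)) := by
    rw [sub_sub_cancel, ← Real.exp_nat_mul, mul_one_div, ← Real.exp_sub,
      show -(t * (1 - c + n)) - ((n + 1 : ℕ) : ℝ) * -t = t * c by push_cast; ring] at h
    refine (congrArg (HasSum · _) (funext fun j => ?_)).mpr h
    rw [sKernel_add, add_comm n]
  have h3 : Summable (sKernel c t n) := (summable_nat_add_iff' n).1 h2.summable
  have h4 := (add_right_injective n).hasSum_iff (f := sKernel c t n) (a := Real.exp (t * c))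
    fun m hm => sKernel_eq_zero (not_le.1 fun h => hm ⟨m - n, Nat.add_sub_cancel' h⟩)
  exact h4.1 h2

/-- Column sums, from the binomial theorem for `e^{-t} + (1 - e^{-t}) = 1`. -/
theorem sum_sKernel (c t : ℝ) (m : ℕ) :
    ∑ n ∈ Finset.range (m + 1), sKernel c t n m = Real.exp (-(t * (1 - c))) := by
  have h := add_pow (Real.exp (-t)) (1 - Real.exp (-t)) m
  rw [add_sub_cancel, one_pow] at h
  calc _ = Real.exp (-(t * (1 - c))) * ∑ n ∈ Finset.range (m + 1),
        Real.exp (-t) ^ n * (1 - Real.exp (-t)) ^ (m - n) * (m.choose n : ℝ) := by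
        rw [Finset.mul_sum]
        refine Finset.sum_congr rfl fun n _ => ?_
        rw [sKernel, ← Real.exp_nat_mul, show -(t * (1 - c + n)) = -(t * (1 - c)) + n * -t by ring,
          Real.exp_add]
        ring
    _ = _ := by rw [← h, mul_one]

/-- Fubini for the product of a row `K` with a matrix `L`, with `b` dominating the absolute sums of
`L` against `f`. -/
theorem tsum_kernel_comp {K : ℕ → ℂ} {L : ℕ → ℕ → ℂ} {f : ℕ → ℂ} {b : ℕ → ℝ}
    (h1 : ∀ l, Summable fun m => ‖L l m * f m‖) (h2 : ∀ l, ∑' m, ‖L l m * f m‖ ≤ b l)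
    (h3 : Summable fun l => ‖K l‖ * b l) :
    ∑' l, K l * ∑' m, L l m * f m = ∑' m, (∑' l, K l * L l m) * f m := by
  have h4 : Summable (Function.uncurry fun l m => K l * (L l m * f m)) := by
    refine Summable.of_norm ?_
    refine (summable_prod_of_nonneg fun x => norm_nonneg _).2 ⟨fun l => ?_, ?_⟩
    · simpa [Function.uncurry, norm_mul] using (h1 l).mul_left ‖K l‖
    · refine Summable.of_nonneg_of_le (fun l => tsum_nonneg fun m => norm_nonneg _) (fun l => ?_) h3
      simp only [Function.uncurry, norm_mul (K l)]
      rw [tsum_mul_left]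
      exact mul_le_mul_of_nonneg_left (h2 l) (norm_nonneg _)
  calc _ = ∑' l, ∑' m, K l * (L l m * f m) := tsum_congr fun l => tsum_mul_left.symm
    _ = ∑' m, ∑' l, K l * (L l m * f m) := h4.tsum_comm.symm
    _ = _ := tsum_congr fun m => by simp only [← tsum_mul_right, mul_assoc]

theorem tsum_weylKernel_mul_weylKernel (a b : ℂ) (n m : ℕ) :
    ∑' l, weylKernel a n l * weylKernel b l m = weylKernel (a + b) n m := by
  rw [← tsum_nat_add_eq_tsum _ n fun l hl => by simp [weylKernel, not_le.2 hl]]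
  by_cases h : n ≤ m
  · obtain ⟨N, rfl⟩ := Nat.exists_eq_add_of_le h
    rw [tsum_eq_sum (s := Finset.range (N + 1))]
    · simp only [weylKernel, le_add_iff_nonneg_right, zero_le, if_true, Nat.add_sub_cancel_left]
      rw [← sum_cesaroNumber_mul]
      refine Finset.sum_congr rfl fun i hi => ?_
      have hi : i ≤ N := by simpa [Nat.lt_succ_iff] using hi
      rw [if_pos (by omega), show n + N - (n + i) = N - i by omega]
    · intro j hj
      have hj : N < j := by simpa using hj
      rw [weylKernel, weylKernel, if_neg (show ¬ n + j ≤ n + N by omega), mul_zero]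
  · rw [weylKernel, if_neg h]
    refine (tsum_congr fun j => ?_).trans tsum_zero
    rw [weylKernel, weylKernel, if_neg (show ¬ n + j ≤ m by omega), mul_zero]

/-- The combinatorial core of the commutation of `D^α` with `S_p(t)`, for `x = e^{-t}`. The binomial
coefficient is `k^{n+j+1}(N-j)`; splitting it by Chu-Vandermonde and exchanging the sums leaves an
inner sum that the binomial theorem evaluates. -/
theorem sum_cesaroNumber_mul_choose (α : ℂ) (n N : ℕ) (x : ℂ) :
    ∑ j ∈ Finset.range (N + 1), cesaroNumber (-α) j * (x ^ j *
        (((n + N).choose (n + j) : ℂ) * (1 - x) ^ (N - j))) =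
      ∑ i ∈ Finset.range (N + 1), cesaroNumber (α + 1 + n) i * (1 - x) ^ i *
        cesaroNumber (-α) (N - i) := by
  -- Since `k^{-α}(j) k^{-α+j}(M-j) = C(M, j) k^{-α}(M)`, this is `(x + (1 - x))^M = 1` times
  -- `k^{-α}(M)`.
  have hM : ∀ M : ℕ, ∑ j ∈ Finset.range (M + 1), cesaroNumber (-α) j *
      cesaroNumber (-α + j) (M - j) * (x ^ j * (1 - x) ^ (M - j)) = cesaroNumber (-α) M := by
    intro M
    have h := add_pow x (1 - x) M
    rw [add_sub_cancel, one_pow] at h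
    refine Eq.trans ?_ ((congrArg (cesaroNumber (-α) M * ·) h.symm).trans (mul_one _))
    simp only [Finset.mul_sum]
    refine Finset.sum_congr rfl fun j hj => ?_
    have hj : j ≤ M := by simpa [Nat.lt_succ_iff] using hj
    obtain ⟨i, rfl⟩ := Nat.exists_eq_add_of_le hj
    rw [← choose_mul_cesaroNumber_add, Nat.add_sub_cancel_left]
    ring
  calc _ = ∑ j ∈ Finset.range (N + 1), ∑ i ∈ Finset.range (N - j + 1),
        cesaroNumber (-α) j * x ^ j * (1 - x) ^ (N - j) *
          (cesaroNumber (α + 1 + n) i * cesaroNumber (-α + j) (N - j - i)) := by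
        refine Finset.sum_congr rfl fun j hj => ?_
        have hj : j ≤ N := by simpa [Nat.lt_succ_iff] using hj
        -- The split is `(α + 1 + n) + (-α + j) = n + j + 1`.
        rw [← Finset.mul_sum, sum_cesaroNumber_mul]
        have h := choose_mul_cesaroNumber_add 1 (n + j) (N - j)
        rw [cesaroNumber_one, cesaroNumber_one, mul_one, one_mul,
          show n + j + (N - j) = n + N by omega] at h
        rw [h]
        push_cast
        ring_nf
    _ = ∑ i ∈ Finset.range (N + 1), ∑ j ∈ Finset.range (N - i + 1),
        cesaroNumber (-α) j * x ^ j * (1 - x) ^ (N - j) *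
          (cesaroNumber (α + 1 + n) i * cesaroNumber (-α + j) (N - j - i)) := by
        refine Finset.sum_comm' fun i j => ?_
        simp only [Finset.mem_range]
        omega
    _ = _ := by
        refine Finset.sum_congr rfl fun i hi => ?_
        have hi : i ≤ N := by simpa [Nat.lt_succ_iff] using hi
        rw [← hM (N - i), Finset.mul_sum]
        refine Finset.sum_congr rfl fun j hj => ?_
        have hj : j ≤ N - i := by simpa [Nat.lt_succ_iff] using hj
        rw [show N - j - i = N - i - j by omega, show N - j = i + (N - i - j) by omega, pow_add]
        ring

/-- The matrices of `D^α` and of `S_p(t)` commute. -/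
theorem tsum_weylKernel_mul_sKernel (α c t : ℝ) (n m : ℕ) :
    ∑' l, cesaroNumber ((α : ℂ) + 1) n * weylKernel (-α) n l * (sKernel c t l m : ℂ) =
      ∑' l, (sKernel c t n l : ℂ) * (cesaroNumber ((α : ℂ) + 1) l * weylKernel (-α) l m) := by
  refine (tsum_nat_add_eq_tsum (fun l => cesaroNumber ((α : ℂ) + 1) n * weylKernel (-α) n l *
    (sKernel c t l m : ℂ)) n fun l hl => by simp [weylKernel, not_le.2 hl]).symm.trans
    (Eq.trans ?_ (tsum_nat_add_eq_tsum (fun l => (sKernel c t n l : ℂ) *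
      (cesaroNumber ((α : ℂ) + 1) l * weylKernel (-α) l m)) n
        fun l hl => by simp [sKernel_eq_zero hl]))
  by_cases h : n ≤ m
  · obtain ⟨N, rfl⟩ := Nat.exists_eq_add_of_le h
    rw [tsum_eq_sum (s := Finset.range (N + 1)), tsum_eq_sum (s := Finset.range (N + 1))]
    · have h1 := congrArg ((Real.exp (-(t * (1 - c + n))) : ℂ) * cesaroNumber ((α : ℂ) + 1) n * ·)
        (sum_cesaroNumber_mul_choose α n N (Real.exp (-t)))
      simp only [Finset.mul_sum] at h1
      convert h1 using 1
      · refine Finset.sum_congr rfl fun j hj => ?_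
        rw [weylKernel, if_pos (by omega), sKernel, Nat.add_sub_cancel_left,
          show n + N - (n + j) = N - j by omega, show -(t * (1 - c + ((n + j : ℕ) : ℝ))) =
            -(t * (1 - c + n)) + j * -t by push_cast; ring, Real.exp_add, Real.exp_nat_mul]
        push_cast
        ring
      · refine Finset.sum_congr rfl fun i hi => ?_
        have hi : i ≤ N := by simpa [Nat.lt_succ_iff] using hi
        rw [weylKernel, if_pos (by omega), sKernel_add, show n + N - (n + i) = N - i by omega]
        push_cast
        linear_combination (Complex.exp (-(t * (1 - c + n))) * (1 - Complex.exp (-t)) ^ i *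
          cesaroNumber (-α) (N - i)) * choose_mul_cesaroNumber_add ((α : ℂ) + 1) n i
    · intro j hj
      have hj : N < j := by simpa using hj
      rw [weylKernel, if_neg (show ¬ n + j ≤ n + N by omega), mul_zero, mul_zero]
    · intro j hj
      have hj : N < j := by simpa using hj
      rw [sKernel_eq_zero (show n + N < n + j by omega), Complex.ofReal_zero, mul_zero]
  · refine tsum_congr fun j => ?_
    rw [sKernel_eq_zero (show m < n + j by omega), weylKernel.eq_def _ (n + j) m,
      if_neg (show ¬ n + j ≤ m by omega)]
    simp

/-- The matrices of `S_p(s)` and `S_p(t)` have product that of `S_p(s + t)`. -/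
theorem tsum_sKernel_mul_sKernel (c s t : ℝ) (n m : ℕ) :
    ∑' l, (sKernel c s n l : ℂ) * (sKernel c t l m : ℂ) = (sKernel c (s + t) n m : ℂ) := by
  rw [← tsum_nat_add_eq_tsum _ n fun l hl => by simp [sKernel_eq_zero hl]]
  by_cases h : n ≤ m
  · obtain ⟨N, rfl⟩ := Nat.exists_eq_add_of_le h
    rw [tsum_eq_sum (s := Finset.range (N + 1))]
    · norm_cast
      have h1 : 1 - Real.exp (-(s + t)) = Real.exp (-t) * (1 - Real.exp (-s)) +
          (1 - Real.exp (-t)) := by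
        rw [neg_add, Real.exp_add]; ring
      rw [sKernel_add, h1, add_pow, Finset.mul_sum, Finset.mul_sum]
      refine Finset.sum_congr rfl fun i hi => ?_
      have hi : i ≤ N := by simpa [Nat.lt_succ_iff] using hi
      have h2 : ((n + N).choose (n + i) : ℝ) * ((n + i).choose n) =
          (n + N).choose n * N.choose i := by
        have := Nat.choose_mul (n := n + N) (k := n + i) (s := n) (by omega)
        simpa [Nat.add_sub_cancel_left] using congrArg (Nat.cast (R := ℝ)) this
      rw [sKernel_add, sKernel, show n + N - (n + i) = N - i by omega, mul_pow,
        show -(t * (1 - c + ((n + i : ℕ) : ℝ))) = -(t * (1 - c + n)) + i * -t by push_cast; ring,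
        show -((s + t) * (1 - c + n)) = -(s * (1 - c + n)) + -(t * (1 - c + n)) by ring,
        Real.exp_add, Real.exp_add, Real.exp_nat_mul]
      linear_combination (Real.exp (-(s * (1 - c + n))) * Real.exp (-(t * (1 - c + n))) *
        Real.exp (-t) ^ i * (1 - Real.exp (-s)) ^ i * (1 - Real.exp (-t)) ^ (N - i)) * h2
    · intro j hj
      have hj : N < j := by simpa using hj
      rw [sKernel_eq_zero (show n + N < n + j by omega), Complex.ofReal_zero, mul_zero]
  · rw [sKernel_eq_zero (not_le.1 h)]
    refine (tsum_congr fun j => ?_).trans (tsum_zero.trans Complex.ofReal_zero.symm)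
    rw [sKernel_eq_zero (show m < n + j by omega), Complex.ofReal_zero, mul_zero]

/-! ### Actions of `S_p(t)` and `D^α` on sequences, and their commutation -/

/-- Bounded sequences. -/
def BoundedSeq (f : ℕ → ℂ) : Prop := ∃ C : ℝ, ∀ n, ‖f n‖ ≤ C

/-- Sequences of slow growth, to which all `S_p(t)` can be applied. -/
def Tame (f : ℕ → ℂ) : Prop :=
  ∀ x : ℝ, 0 ≤ x → x < 1 → ∀ n, Summable fun j => ((n + j).choose n : ℝ) * x ^ j * ‖f (n + j)‖

/-- The coordinatewise action of the generator of `S_p`. -/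
noncomputable def genB (p : ℝ≥0∞) (f : ℕ → ℂ) (n : ℕ) : ℂ :=
  -(1 - ((1 / p).toReal : ℂ) + n) * f n + (n + 1) * f (n + 1)

theorem BoundedSeq.sub {f g : ℕ → ℂ} (hf : BoundedSeq f) (hg : BoundedSeq g) :
    BoundedSeq (f - g) := by
  obtain ⟨C, hC⟩ := hf
  obtain ⟨C', hC'⟩ := hg
  exact ⟨C + C', fun n => (norm_sub_le _ _).trans (add_le_add (hC n) (hC' n))⟩

theorem BoundedSeq.smul {f : ℕ → ℂ} (hf : BoundedSeq f) (z : ℂ) : BoundedSeq (z • f) := by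
  obtain ⟨C, hC⟩ := hf
  exact ⟨‖z‖ * C, fun n => by
    simpa using mul_le_mul_of_nonneg_left (hC n) (norm_nonneg z)⟩

theorem BoundedSeq.of_tendsto {f : ℕ → ℂ} {z : ℂ} (hf : Tendsto f atTop (𝓝 z)) :
    BoundedSeq f := by
  obtain ⟨C, hC⟩ := (Metric.isBounded_range_of_tendsto f hf).exists_norm_le
  exact ⟨C, fun n => hC _ ⟨n, rfl⟩⟩

/-- The dominating series is `|k^a(n)|` times the binomial series of parameter `a + n`, absolutely
convergent on the unit disc. Polynomial growth must be allowed because `D^α f` can be unbounded for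
bounded `f`. -/
theorem Tame.of_norm_le {f : ℕ → ℂ} {a : ℂ} {C : ℝ} (h : ∀ n, ‖f n‖ ≤ C * ‖cesaroNumber a n‖) :
    Tame f := by
  intro x hx0 hx1 n
  have h1 := ((summable_norm_cesaroNumber_mul_pow (a + n) (x := x)
    (by rwa [abs_of_nonneg hx0])).mul_left (C * ‖cesaroNumber a n‖))
  refine Summable.of_nonneg_of_le (fun j => by positivity) (fun j => ?_) h1
  have h2 := congrArg norm (choose_mul_cesaroNumber_add a n j)
  simp only [norm_mul, Complex.norm_natCast] at h2
  rw [abs_of_nonneg hx0]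
  calc _ ≤ ((n + j).choose n : ℝ) * x ^ j * (C * ‖cesaroNumber a (n + j)‖) :=
        mul_le_mul_of_nonneg_left (h _) (by positivity)
    _ = _ := by linear_combination (x ^ j * C) * h2

theorem BoundedSeq.tame {f : ℕ → ℂ} (hf : BoundedSeq f) : Tame f := by
  obtain ⟨C, hC⟩ := hf
  exact Tame.of_norm_le (a := 1) (C := C) fun n => by simpa [cesaroNumber_one] using hC n

theorem tame_cesaroNumber (a : ℂ) : Tame (cesaroNumber a) :=
  Tame.of_norm_le (a := a) (C := 1) fun n => by simp

theorem Tame.sub {f g : ℕ → ℂ} (hf : Tame f) (hg : Tame g) : Tame (f - g) := by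
  intro x hx0 hx1 n
  refine Summable.of_nonneg_of_le (fun j => by positivity) (fun j => ?_)
    ((hf x hx0 hx1 n).add (hg x hx0 hx1 n))
  rw [← mul_add]
  exact mul_le_mul_of_nonneg_left (norm_sub_le _ _) (by positivity)

theorem Tame.summable {f : ℕ → ℂ} (hf : Tame f) (c : ℝ) {t : ℝ} (ht : 0 ≤ t) (n : ℕ) :
    Summable fun m => ‖(sKernel c t n m : ℂ) * f m‖ := by
  obtain ⟨h0, h1⟩ := one_sub_exp_neg_mem ht
  refine (summable_nat_add_iff' n).1 (((hf _ h0 h1 n).mul_left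
    (Real.exp (-(t * (1 - c + n))))).congr fun j => ?_)
  rw [norm_mul, norm_sKernel ht, sKernel_add]
  ring

theorem semigroupS_sub {f g : ℕ → ℂ} (hf : Tame f) (hg : Tame g) (p : ℝ≥0∞) {t : ℝ}
    (ht : 0 ≤ t) : semigroupS p t (f - g) = semigroupS p t f - semigroupS p t g := by
  ext n
  simp only [semigroupS_eq_tsum, Pi.sub_apply, mul_sub]
  exact (hf.summable _ ht n).of_norm.tsum_sub (hg.summable _ ht n).of_norm

theorem semigroupS_smul (p : ℝ≥0∞) (t : ℝ) (z : ℂ) (f : ℕ → ℂ) :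
    semigroupS p t (z • f) = z • semigroupS p t f := by
  ext n
  simp only [semigroupS_eq_tsum, Pi.smul_apply, smul_eq_mul, ← tsum_mul_left]
  exact tsum_congr fun m => by ring

/-- Only the entries from `n` on enter, so the estimate also shows that decay at infinity is
preserved. -/
theorem norm_semigroupS_le (p : ℝ≥0∞) {t : ℝ} (ht : 0 ≤ t) {f : ℕ → ℂ} {C : ℝ} {n : ℕ}
    (hC : ∀ m, n ≤ m → ‖f m‖ ≤ C) :
    ‖semigroupS p t f n‖ ≤ Real.exp (t * (1 / p).toReal) * C := by
  rw [semigroupS_eq_tsum]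
  refine tsum_of_norm_bounded ((hasSum_sKernel ht n).mul_right C) fun m => ?_
  rw [norm_mul, norm_sKernel ht]
  rcases lt_or_ge m n with h | h
  · simp [sKernel_eq_zero h]
  · exact mul_le_mul_of_nonneg_left (hC m h) (sKernel_nonneg ht n m)

theorem BoundedSeq.semigroupS {f : ℕ → ℂ} (hf : BoundedSeq f) (p : ℝ≥0∞) {t : ℝ} (ht : 0 ≤ t) :
    BoundedSeq (semigroupS p t f) := by
  obtain ⟨C, hC⟩ := hf
  exact ⟨_, fun n => norm_semigroupS_le p ht fun m _ => hC m⟩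

theorem summable_norm_weylKernel_neg {α : ℝ} (hα : 0 ≤ α) (n : ℕ) :
    Summable fun m => ‖weylKernel (-(α : ℂ)) n m‖ :=
  (summable_nat_add_iff' n).1 (by simpa [weylKernel] using summable_norm_cesaroNumber_neg hα)

theorem tsum_norm_weylKernel_neg (α : ℝ) (n : ℕ) :
    ∑' m, ‖weylKernel (-(α : ℂ)) n m‖ = ∑' j, ‖cesaroNumber (-(α : ℂ)) j‖ := by
  have := (add_right_injective n).tsum_eq (f := fun m => ‖weylKernel (-(α : ℂ)) n m‖)
    fun m hm => ⟨m - n, Nat.add_sub_cancel' (not_lt.1 fun h => hm (by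
      simp [weylKernel, not_le.2 h]))⟩
  rw [← this]
  simp [weylKernel]

theorem summable_weylKernel_mul {α : ℝ} (hα : 0 ≤ α) {f : ℕ → ℂ} (hf : BoundedSeq f) (n : ℕ) :
    Summable fun m => ‖weylKernel (-(α : ℂ)) n m * f m‖ := by
  obtain ⟨C, hC⟩ := hf
  refine Summable.of_nonneg_of_le (fun j => by positivity) (fun j => ?_)
    ((summable_norm_weylKernel_neg hα n).mul_right C)
  rw [norm_mul]
  exact mul_le_mul_of_nonneg_left (hC j) (norm_nonneg _)

theorem tsum_norm_weylKernel_mul_le {α : ℝ} (hα : 0 ≤ α) {f : ℕ → ℂ} {C : ℝ}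
    (hC : ∀ n, ‖f n‖ ≤ C) (n : ℕ) :
    ∑' m, ‖weylKernel (-(α : ℂ)) n m * f m‖ ≤ (∑' j, ‖cesaroNumber (-(α : ℂ)) j‖) * C := by
  rw [← tsum_norm_weylKernel_neg α n, ← tsum_mul_right]
  refine (summable_weylKernel_mul hα ⟨C, hC⟩ n).tsum_le_tsum (fun m => ?_)
    ((summable_norm_weylKernel_neg hα n).mul_right C)
  rw [norm_mul]
  exact mul_le_mul_of_nonneg_left (hC m) (norm_nonneg _)

theorem weightedWeyl_eq_tsum (α : ℝ) (f : ℕ → ℂ) (n : ℕ) : weightedWeyl α f n =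
    ∑' m, cesaroNumber ((α : ℂ) + 1) n * weylKernel (-α) n m * f m := by
  simp only [weightedWeyl, weylDifference_eq_tsum, mul_assoc, tsum_mul_left]

theorem weylDifference_sub {α : ℝ} (hα : 0 ≤ α) {f g : ℕ → ℂ} (hf : BoundedSeq f)
    (hg : BoundedSeq g) : weylDifference α (f - g) = weylDifference α f - weylDifference α g := by
  ext n
  simp only [weylDifference_eq_tsum, Pi.sub_apply, mul_sub]
  exact (summable_weylKernel_mul hα hf n).of_norm.tsum_sub
    (summable_weylKernel_mul hα hg n).of_norm

theorem weightedWeyl_sub {α : ℝ} (hα : 0 ≤ α) {f g : ℕ → ℂ} (hf : BoundedSeq f)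
    (hg : BoundedSeq g) : weightedWeyl α (f - g) = weightedWeyl α f - weightedWeyl α g := by
  ext n
  simp [weightedWeyl, weylDifference_sub hα hf hg, mul_sub]

theorem weightedWeyl_smul (α : ℝ) (z : ℂ) (f : ℕ → ℂ) :
    weightedWeyl α (z • f) = z • weightedWeyl α f := by
  ext n
  simp only [weightedWeyl, weylDifference, Pi.smul_apply, smul_eq_mul, mul_left_comm _ z,
    tsum_mul_left]

theorem norm_weylDifference_le {α : ℝ} (hα : 0 ≤ α) {f : ℕ → ℂ} {C : ℝ}
    (hC : ∀ n, ‖f n‖ ≤ C) (n : ℕ) :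
    ‖weylDifference α f n‖ ≤ (∑' j, ‖cesaroNumber (-(α : ℂ)) j‖) * C := by
  rw [weylDifference_eq_tsum]
  exact (norm_tsum_le_tsum_norm (summable_weylKernel_mul hα ⟨C, hC⟩ n)).trans
    (tsum_norm_weylKernel_mul_le hα hC n)

theorem norm_weightedWeyl_le {α : ℝ} (hα : 0 ≤ α) {f : ℕ → ℂ} {C : ℝ}
    (hC : ∀ n, ‖f n‖ ≤ C) (n : ℕ) : ‖weightedWeyl α f n‖ ≤
      (∑' j, ‖cesaroNumber (-(α : ℂ)) j‖) * C * ‖cesaroNumber ((α : ℂ) + 1) n‖ := by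
  rw [weightedWeyl, norm_mul, mul_comm]
  exact mul_le_mul_of_nonneg_right (norm_weylDifference_le hα hC n) (norm_nonneg _)

theorem BoundedSeq.tame_weightedWeyl {α : ℝ} (hα : 0 ≤ α) {f : ℕ → ℂ} (hf : BoundedSeq f) :
    Tame (weightedWeyl α f) := by
  obtain ⟨C, hC⟩ := hf
  exact Tame.of_norm_le (norm_weightedWeyl_le hα hC)

theorem tendsto_weightedWeyl {ι : Type*} {l : Filter ι} {α : ℝ} (hα : 0 ≤ α)
    {u : ι → ℕ → ℂ} {f : ℕ → ℂ} {C : ℝ} (hC : ∀ᶠ i in l, ∀ n, ‖u i n‖ ≤ C)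
    (h : ∀ n, Tendsto (fun i => u i n) l (𝓝 (f n))) (n : ℕ) :
    Tendsto (fun i => weightedWeyl α (u i) n) l (𝓝 (weightedWeyl α f n)) := by
  simp only [weightedWeyl, weylDifference_eq_tsum]
  refine Tendsto.const_mul _ (tendsto_tsum_of_dominated_convergence
    ((summable_norm_weylKernel_neg hα n).mul_right C) (fun m => (h m).const_mul _) ?_)
  filter_upwards [hC] with i hi m
  rw [norm_mul]
  exact mul_le_mul_of_nonneg_left (hi m) (norm_nonneg _)

/-- `D^α` commutes with `S_p(t)` on bounded sequences. -/
theorem weightedWeyl_semigroupS {α : ℝ} (hα : 0 ≤ α) (p : ℝ≥0∞) {t : ℝ} (ht : 0 ≤ t)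
    {f : ℕ → ℂ} (hf : BoundedSeq f) :
    weightedWeyl α (semigroupS p t f) = semigroupS p t (weightedWeyl α f) := by
  obtain ⟨C, hC⟩ := hf
  have hC0 : 0 ≤ C := (norm_nonneg _).trans (hC 0)
  ext n
  rw [weightedWeyl_eq_tsum, semigroupS_eq_tsum]
  simp only [semigroupS_eq_tsum, weightedWeyl_eq_tsum]
  rw [tsum_kernel_comp (b := fun _ => Real.exp (t * (1 / p).toReal) * C)
      (K := fun m => cesaroNumber ((α : ℂ) + 1) n * weylKernel (-α) n m),
    tsum_kernel_comp (b := fun l => (∑' j, ‖cesaroNumber (-(α : ℂ)) j‖) * C *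
        ‖cesaroNumber ((α : ℂ) + 1) l‖) (K := fun m => (sKernel (1 / p).toReal t n m : ℂ))]
  · simp only [tsum_weylKernel_mul_sKernel]
  · intro l
    simpa only [mul_assoc, norm_mul] using
      (summable_weylKernel_mul hα ⟨C, hC⟩ l).mul_left ‖cesaroNumber ((α : ℂ) + 1) l‖
  · intro l
    simp only [mul_assoc (cesaroNumber ((α : ℂ) + 1) l), norm_mul (cesaroNumber ((α : ℂ) + 1) l)]
    rw [tsum_mul_left, mul_comm]
    exact mul_le_mul_of_nonneg_right (tsum_norm_weylKernel_mul_le hα hC l) (norm_nonneg _)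
  -- The `l`-th row of `D^α` contributes a multiple of `|k^{α+1}(l)|`, unbounded in `l` for `α > 0`
  -- but summable against the rows of `S_p(t)`.
  · refine (((tame_cesaroNumber ((α : ℂ) + 1)).summable (1 / p).toReal ht n).mul_left
      ((∑' j, ‖cesaroNumber (-(α : ℂ)) j‖) * C)).congr fun l => ?_
    rw [norm_mul]
    ring
  · exact fun l => BoundedSeq.tame ⟨C, hC⟩ |>.summable _ ht l
  · intro l
    refine (BoundedSeq.tame ⟨C, hC⟩ |>.summable _ ht l).tsum_le_of_sum_le fun s => ?_
    refine (Finset.sum_le_sum fun m _ => ?_).trans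
      (sum_le_hasSum s (fun m _ => mul_nonneg (sKernel_nonneg ht l m) hC0)
        ((hasSum_sKernel ht l).mul_right C))
    rw [norm_mul, norm_sKernel ht]
    exact mul_le_mul_of_nonneg_left (hC m) (sKernel_nonneg ht l m)
  · simp only [norm_mul]
    exact ((summable_norm_weylKernel_neg hα n).mul_left _).mul_right _

theorem semigroupS_semigroupS (p : ℝ≥0∞) {s t : ℝ} (hs : 0 ≤ s) (ht : 0 ≤ t)
    {f : ℕ → ℂ} (hf : BoundedSeq f) :
    semigroupS p s (semigroupS p t f) = semigroupS p (s + t) f := by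
  obtain ⟨C, hC⟩ := hf
  have hC0 : 0 ≤ C := (norm_nonneg _).trans (hC 0)
  ext n
  rw [semigroupS_eq_tsum, semigroupS_eq_tsum]
  simp only [semigroupS_eq_tsum]
  rw [tsum_kernel_comp (b := fun _ => Real.exp (t * (1 / p).toReal) * C)
      (K := fun m => (sKernel (1 / p).toReal s n m : ℂ))]
  · simp only [tsum_sKernel_mul_sKernel]
  · exact fun l => BoundedSeq.tame ⟨C, hC⟩ |>.summable _ ht l
  · intro l
    refine (BoundedSeq.tame ⟨C, hC⟩ |>.summable _ ht l).tsum_le_of_sum_le fun s => ?_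
    refine (Finset.sum_le_sum fun m _ => ?_).trans
      (sum_le_hasSum s (fun m _ => mul_nonneg (sKernel_nonneg ht l m) hC0)
        ((hasSum_sKernel ht l).mul_right C))
    rw [norm_mul, norm_sKernel ht]
    exact mul_le_mul_of_nonneg_left (hC m) (sKernel_nonneg ht l m)
  · simp only [norm_sKernel hs]
    exact (hasSum_sKernel hs n).summable.mul_right _

/-! ### Eigenvectors of `S_p(t)` and its coordinatewise derivative -/

/-- The sequences `k^{λ + 1 - 1/p}` are eigenvectors of `S_p(t)`. -/
theorem semigroupS_cesaroNumber (p : ℝ≥0∞) {t : ℝ} (ht : 0 ≤ t) (z : ℂ) :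
    semigroupS p t (cesaroNumber (z + 1 - (1 / p).toReal)) =
      Complex.exp (z * t) • cesaroNumber (z + 1 - (1 / p).toReal) := by
  obtain ⟨h0, h1⟩ := one_sub_exp_neg_mem ht
  set a := z + 1 - ((1 / p).toReal : ℂ) with ha
  ext n
  have h := hasSum_cesaroNumber_mul_pow (a + n) (x := 1 - Real.exp (-t))
    (by rwa [abs_of_nonneg h0])
  -- The binomial series sums to `e^{t(a+n)}`; the prefactor `e^{-t(1-1/p+n)}` then leaves `e^{tz}`.
  have h2 : (1 : ℂ) / (1 - ((1 - Real.exp (-t) : ℝ) : ℂ)) ^ (a + n) =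
      Complex.exp (t * (a + n)) := by
    have h3 : (1 - ((1 - Real.exp (-t) : ℝ) : ℂ)) = Complex.exp ((-t : ℝ) : ℂ) := by
      push_cast; ring
    rw [h3, Complex.cpow_def_of_ne_zero (Complex.exp_ne_zero _), ← Complex.ofReal_exp,
      ← Complex.ofReal_log (Real.exp_pos _).le, Real.log_exp, one_div, ← Complex.exp_neg]
    congr 1
    push_cast
    ring
  rw [h2] at h
  have h4 : ∀ j : ℕ, ((((n + j).choose n : ℝ) * (1 - Real.exp (-t)) ^ j : ℝ) : ℂ) *
      cesaroNumber a (n + j) =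
        cesaroNumber a n * (cesaroNumber (a + n) j * ((1 - Real.exp (-t) : ℝ) : ℂ) ^ j) := by
    intro j
    push_cast
    linear_combination (1 - Complex.exp (-t)) ^ j * choose_mul_cesaroNumber_add a n j
  simp only [semigroupS, h4]
  rw [tsum_mul_left, h.tsum_eq, Pi.smul_apply, smul_eq_mul, mul_left_comm, mul_comm,
    Complex.ofReal_exp, ← Complex.exp_add]
  congr 2
  rw [ha]
  push_cast
  ring

theorem tendsto_exp_sub_one_div (z : ℂ) :
    Tendsto (fun t : ℝ => (t : ℂ)⁻¹ * (Complex.exp (z * t) - 1)) (𝓝[>] 0) (𝓝 z) := by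
  have h : HasDerivAt (fun t : ℝ => Complex.exp (z * t)) z 0 := by
    have := ((Complex.ofRealCLM.hasDerivAt (x := (0 : ℝ))).const_mul z).cexp
    simpa using this
  have := (hasDerivWithinAt_iff_tendsto_slope' (s := Set.Ioi 0) (by simp)).1 h.hasDerivWithinAt
  simpa [slope_fun_def] using this

/-- The coordinatewise derivative of `S_p(t) f` at `t = 0`. -/
theorem tendsto_diffQuotient_semigroupS (p : ℝ≥0∞) {f : ℕ → ℂ} (hf : Tame f) (n : ℕ) :
    Tendsto (fun t : ℝ => diffQuotient (semigroupS p) f t n) (𝓝[>] 0) (𝓝 (genB p f n)) := by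
  set c := (1 / p).toReal
  set a : ℕ → ℂ := fun j => ((n + j).choose n : ℂ) * f (n + j) with ha
  have hsum : ∀ x : ℝ, 0 ≤ x → x < 1 → Summable fun j => ‖a j‖ * x ^ j := fun x h0 h1 => by
    refine (hf x h0 h1 n).congr fun j => ?_
    simp only [ha, norm_mul, Complex.norm_natCast]
    ring
  -- Expansion in `x = 1 - e^{-t}`: the terms of order `0` and `1` carry the derivative, and the
  -- rest is `x² R(x)`. Boundedness of `R` on `[0, 1/2]` makes it negligible after division by `t`.
  set R : ℝ → ℂ := fun x => ∑' j, a (j + 2) * (x : ℂ) ^ j with hR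
  have hexp : ∀ t : ℝ, 0 ≤ t → semigroupS p t f n = Complex.exp (-(1 - c + n) * t) *
      (f n + (1 - Complex.exp (-1 * t)) * ((n + 1) * f (n + 1)) +
        (1 - Complex.exp (-1 * t)) ^ 2 * R (1 - Real.exp (-t))) := by
    intro t ht
    obtain ⟨h0, h1⟩ := one_sub_exp_neg_mem ht
    set x := 1 - Real.exp (-t) with hx
    have hs : Summable fun j => a j * (x : ℂ) ^ j := by
      refine Summable.of_norm ((hsum x h0 h1).congr fun j => ?_)
      rw [norm_mul (a j), norm_pow, Complex.norm_of_nonneg h0]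
    have hxx : (1 - Complex.exp (-1 * t)) = x := by rw [hx]; push_cast; ring_nf
    have h2 := hs.sum_add_tsum_nat_add 2
    simp only [Finset.sum_range_succ, Finset.sum_range_zero, zero_add, pow_zero, mul_one,
      pow_one, pow_add] at h2
    rw [hxx, semigroupS]
    have h3 : ∑' j : ℕ, ((((n + j).choose n : ℝ) * x ^ j : ℝ) : ℂ) * f (n + j) =
        ∑' j, a j * (x : ℂ) ^ j := tsum_congr fun j => by
      simp only [ha]; push_cast; ring
    rw [h3, ← h2, hR]
    have h4 : ∑' j, a (j + 2) * ((x : ℂ) ^ j * (x : ℂ) ^ 2) =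
        (x : ℂ) ^ 2 * ∑' j, a (j + 2) * (x : ℂ) ^ j := by
      rw [← tsum_mul_left]; exact tsum_congr fun j => by ring
    rw [h4]
    have h5 : a 0 = f n := by simp [ha]
    have h6 : a 1 = (n + 1) * f (n + 1) := by simp [ha]
    rw [h5, h6, Complex.ofReal_exp]
    congr 1
    · congr 1; push_cast; ring
    · ring
  set M : ℝ := ∑' j, ‖a (j + 2)‖ * (1 / 2) ^ j with hM
  have hs2 : Summable fun j => ‖a (j + 2)‖ * (1 / 2 : ℝ) ^ j := by
    have := ((summable_nat_add_iff 2).2 (hsum (1 / 2) (by norm_num) (by norm_num))).mul_left 4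
    refine this.congr fun j => ?_
    rw [pow_add]
    ring
  have hRM : ∀ x : ℝ, 0 ≤ x → x ≤ 1 / 2 → ‖R x‖ ≤ M := fun x h0 h1 => by
    refine tsum_of_norm_bounded hs2.hasSum fun j => ?_
    rw [norm_mul, norm_pow, Complex.norm_of_nonneg h0]
    gcongr
  have hpos : ∀ᶠ t : ℝ in 𝓝[>] 0, 0 < t := self_mem_nhdsWithin
  have hexp0 : ∀ w : ℂ, Tendsto (fun t : ℝ => Complex.exp (w * t)) (𝓝[>] 0) (𝓝 1) := fun w => by
    have : Continuous fun t : ℝ => Complex.exp (w * t) := by fun_prop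
    simpa using (this.tendsto 0).mono_left nhdsWithin_le_nhds
  have hx0 : Tendsto (fun t : ℝ => 1 - Complex.exp (-1 * t)) (𝓝[>] 0) (𝓝 0) := by
    simpa using (hexp0 (-1)).const_sub 1
  have hsmall : ∀ᶠ t : ℝ in 𝓝[>] 0, ‖R (1 - Real.exp (-t))‖ ≤ M := by
    have h1 : Tendsto (fun t : ℝ => 1 - Real.exp (-t)) (𝓝[>] 0) (𝓝 0) := by
      have : Continuous fun t : ℝ => 1 - Real.exp (-t) := by fun_prop
      simpa using (this.tendsto 0).mono_left nhdsWithin_le_nhds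
    filter_upwards [hpos, h1.eventually_le_const (show (0 : ℝ) < 1 / 2 by norm_num)] with t ht h2
    exact hRM _ (one_sub_exp_neg_mem ht.le).1 h2
  have hxR : Tendsto (fun t : ℝ => (1 - Complex.exp (-1 * t)) * R (1 - Real.exp (-t)))
      (𝓝[>] 0) (𝓝 0) := by
    refine squeeze_zero_norm' (a := fun t : ℝ => ‖1 - Complex.exp (-1 * t)‖ * M) ?_ ?_
    · filter_upwards [hsmall] with t ht
      rw [norm_mul]
      exact mul_le_mul_of_nonneg_left ht (norm_nonneg _)
    · simpa using hx0.norm.mul_const M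
  have hmain := ((tendsto_exp_sub_one_div (-(1 - c + n))).mul_const (f n)).add
    ((hexp0 (-(1 - c + n))).mul (((tendsto_exp_sub_one_div (-1)).neg).mul
      (tendsto_const_nhds (x := (n + 1) * f (n + 1)) |>.add hxR)))
  have hlim : genB p f n = -(1 - c + n) * f n + 1 * (- -1 * ((n + 1) * f (n + 1) + 0)) := by
    simp only [genB, c]; ring
  rw [hlim]
  refine hmain.congr' ?_
  filter_upwards [hpos] with t ht
  have ht' : (t : ℂ) ≠ 0 := by exact_mod_cast ht.ne'
  simp only [diffQuotient, Pi.smul_apply, Pi.sub_apply, smul_eq_mul]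
  rw [hexp t ht.le]
  ring

/-- The equation determines `f (n + 1)` from `f n` by the Cesaro recursion, so `f 0` fixes
everything. No growth condition is needed. -/
theorem eq_cesaroNumber_of_genB_eq {p : ℝ≥0∞} {z : ℂ} {f : ℕ → ℂ} (h : ∀ n, genB p f n = z * f n) :
    f = f 0 • cesaroNumber (z + 1 - (1 / p).toReal) := by
  ext n
  simp only [Pi.smul_apply, smul_eq_mul]
  induction n with
  | zero => simp [cesaroNumber_zero_right]
  | succ n ih =>
    have h1 : (n : ℂ) + 1 ≠ 0 := by exact_mod_cast n.succ_ne_zero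
    have h2 := h n
    have h3 := cesaroNumber_succ (z + 1 - (1 / p).toReal) n
    rw [genB] at h2
    refine mul_left_cancel₀ h1 ?_
    linear_combination h2 - f 0 * h3 + (z + 1 - (1 / p).toReal + n) * ih

/-! ### The `ℓ^p` norm, truncations and contractivity of `S_p(t)` -/

/-- The `ℓ^p` norm. -/
noncomputable abbrev seqNorm (p : ℝ≥0∞) (f : ℕ → ℂ) : ℝ≥0∞ := eLpNorm f p Measure.count

/-- The sequence `f` vanishes at all indices from `N` on. -/
def VanishesFrom (N : ℕ) (f : ℕ → ℂ) : Prop := ∀ n, N ≤ n → f n = 0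

theorem aestronglyMeasurable_seq (f : ℕ → ℂ) : AEStronglyMeasurable f Measure.count :=
  (Measurable.of_discrete (f := f)).aestronglyMeasurable

theorem seqNorm_add_le {p : ℝ≥0∞} (hp : 1 ≤ p) (f g : ℕ → ℂ) :
    seqNorm p (f + g) ≤ seqNorm p f + seqNorm p g :=
  eLpNorm_add_le (aestronglyMeasurable_seq f) (aestronglyMeasurable_seq g) hp

theorem seqNorm_sub_le {p : ℝ≥0∞} (hp : 1 ≤ p) (f g : ℕ → ℂ) :
    seqNorm p (f - g) ≤ seqNorm p f + seqNorm p g :=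
  eLpNorm_sub_le (aestronglyMeasurable_seq f) (aestronglyMeasurable_seq g) hp

theorem seqNorm_smul (p : ℝ≥0∞) (z : ℂ) (f : ℕ → ℂ) :
    seqNorm p (z • f) = ‖z‖ₑ * seqNorm p f := eLpNorm_const_smul z f p _

theorem seqNorm_eq_zero {p : ℝ≥0∞} (hp : 1 ≤ p) {f : ℕ → ℂ} (h : seqNorm p f = 0) : f = 0 := by
  ext n
  have := (enorm_le_eLpNorm_count f n (zero_lt_one.trans_le hp).ne').trans_eq h
  simpa using this

theorem BoundedSeq.of_seqNorm_lt_top {p : ℝ≥0∞} (hp : 1 ≤ p) {f : ℕ → ℂ}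
    (h : seqNorm p f < ∞) : BoundedSeq f := by
  refine ⟨(seqNorm p f).toReal, fun n => ?_⟩
  have := ENNReal.toReal_mono h.ne (enorm_le_eLpNorm_count f n (zero_lt_one.trans_le hp).ne')
  simpa using this

/-- Fatou's lemma: norm bounds survive coordinatewise limits. -/
theorem seqNorm_le_of_tendsto {ι : Type*} {l : Filter ι} [l.NeBot] [l.IsCountablyGenerated]
    {p : ℝ≥0∞} {u : ι → ℕ → ℂ} {f : ℕ → ℂ} {C : ℝ≥0∞} (hC : ∀ i, seqNorm p (u i) ≤ C)
    (h : ∀ n, Tendsto (fun i => u i n) l (𝓝 (f n))) : seqNorm p f ≤ C :=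
  Lp.eLpNorm_le_of_ae_tendsto (.of_forall hC) (fun i => aestronglyMeasurable_seq (u i))
    (.of_forall h)

theorem VanishesFrom.seqNorm_le {p : ℝ≥0∞} (hp : 1 ≤ p) {N : ℕ} {f : ℕ → ℂ}
    (h : VanishesFrom N f) : seqNorm p f ≤ ∑ n ∈ Finset.range N, ‖f n‖ₑ := by
  have h1 : f = ∑ n ∈ Finset.range N, ({n} : Set ℕ).indicator fun _ => f n := by
    ext m
    rw [Finset.sum_apply]
    by_cases hm : m < N
    · rw [Finset.sum_eq_single m]
      · simp
      · intro b _ hb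
        simp [hb.symm]
      · simp [hm]
    · rw [h m (not_lt.1 hm), Finset.sum_eq_zero]
      intro b hb
      have : m ≠ b := fun h => hm (h ▸ Finset.mem_range.1 hb)
      simp [this]
  calc seqNorm p f
      = seqNorm p (∑ n ∈ Finset.range N, ({n} : Set ℕ).indicator fun _ => f n) := by rw [← h1]
    _ ≤ ∑ n ∈ Finset.range N, seqNorm p (({n} : Set ℕ).indicator fun _ => f n) :=
        eLpNorm_sum_le (fun i _ => aestronglyMeasurable_seq _) hp
    _ ≤ _ := Finset.sum_le_sum fun n _ => by
        simpa using eLpNorm_indicator_const_le (μ := Measure.count) (s := {n}) (f n) p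

theorem VanishesFrom.seqNorm_lt_top {p : ℝ≥0∞} (hp : 1 ≤ p) {N : ℕ} {f : ℕ → ℂ}
    (h : VanishesFrom N f) : seqNorm p f < ∞ :=
  (h.seqNorm_le hp).trans_lt (ENNReal.sum_lt_top.2 fun _ _ => enorm_lt_top)

theorem VanishesFrom.bounded {N : ℕ} {f : ℕ → ℂ} (h : VanishesFrom N f) : BoundedSeq f :=
  .of_seqNorm_lt_top le_rfl (h.seqNorm_lt_top le_rfl)

theorem VanishesFrom.sub {N : ℕ} {f g : ℕ → ℂ} (hf : VanishesFrom N f) (hg : VanishesFrom N g) :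
    VanishesFrom N (f - g) := fun n hn => by simp [hf n hn, hg n hn]

theorem VanishesFrom.smul {N : ℕ} {f : ℕ → ℂ} (hf : VanishesFrom N f) (z : ℂ) :
    VanishesFrom N (z • f) := fun n hn => by simp [hf n hn]

theorem VanishesFrom.genB {N : ℕ} {f : ℕ → ℂ} (hf : VanishesFrom N f) (p : ℝ≥0∞) :
    VanishesFrom N (genB p f) := fun n hn => by
  simp [SobolevLebesgue.genB, hf n hn, hf (n + 1) (by omega)]

theorem VanishesFrom.semigroupS {N : ℕ} {f : ℕ → ℂ} (hf : VanishesFrom N f) (p : ℝ≥0∞) (t : ℝ) :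
    VanishesFrom N (semigroupS p t f) := fun n hn => by
  have : ∀ j, f (n + j) = 0 := fun j => hf _ (by omega)
  simp [SobolevLebesgue.semigroupS, this]

/-- The truncation of a sequence to the indices below `k`. -/
def truncate (k : ℕ) (f : ℕ → ℂ) (n : ℕ) : ℂ := if n < k then f n else 0

theorem truncate_vanishesFrom (k : ℕ) (f : ℕ → ℂ) : VanishesFrom k (truncate k f) :=
  fun n hn => by simp [truncate, not_lt.2 hn]

theorem seqNorm_truncate_le (p : ℝ≥0∞) (k : ℕ) (f : ℕ → ℂ) :
    seqNorm p (truncate k f) ≤ seqNorm p f := by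
  refine eLpNorm_mono fun n => ?_
  rw [truncate]
  split_ifs <;> simp

theorem tendsto_truncate (f : ℕ → ℂ) (n : ℕ) :
    Tendsto (fun k => truncate k f n) atTop (𝓝 (f n)) := by
  refine tendsto_const_nhds.congr' ?_
  filter_upwards [eventually_gt_atTop n] with k hk
  simp [truncate, hk]

theorem seqNorm_eq_tsum {p : ℝ≥0∞} (hp : 1 ≤ p) (hp' : p ≠ ∞) (f : ℕ → ℂ) :
    seqNorm p f = (∑' n, ‖f n‖ₑ ^ p.toReal) ^ (1 / p.toReal) := by
  rw [seqNorm, eLpNorm_eq_lintegral_rpow_enorm_toReal (zero_lt_one.trans_le hp).ne' hp',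
    lintegral_count]

theorem one_le_toReal {p : ℝ≥0∞} (hp : 1 ≤ p) (hp' : p ≠ ∞) : 1 ≤ p.toReal := by
  simpa using ENNReal.toReal_mono hp' hp

theorem tendsto_seqNorm_sub_truncate {p : ℝ≥0∞} (hp : 1 ≤ p) (hp' : p ≠ ∞) {f : ℕ → ℂ}
    (hf : seqNorm p f < ∞) : Tendsto (fun k => seqNorm p (f - truncate k f)) atTop (𝓝 0) := by
  have hP := zero_lt_one.trans_le (one_le_toReal hp hp')
  rw [seqNorm_eq_tsum hp hp', ENNReal.rpow_lt_top_iff_of_pos (by positivity)] at hf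
  have h1 : ∀ k, seqNorm p (f - truncate k f) =
      (∑' n, ‖f (n + k)‖ₑ ^ p.toReal) ^ (1 / p.toReal) := by
    intro k
    rw [seqNorm_eq_tsum hp hp']
    congr 1
    rw [← (add_left_injective k).tsum_eq]
    · refine tsum_congr fun n => ?_
      simp [truncate]
    · intro m hm
      refine ⟨m - k, Nat.sub_add_cancel (not_lt.1 fun h => hm ?_)⟩
      simp [truncate, h, hP]
  simp only [h1]
  have h2 := (ENNReal.tendsto_sum_nat_add _ hf.ne).ennrpow_const (1 / p.toReal)
  rwa [ENNReal.zero_rpow_of_pos (by positivity)] at h2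

theorem tsum_ofReal_sKernel {c t : ℝ} (ht : 0 ≤ t) (n : ℕ) :
    ∑' m, ENNReal.ofReal (sKernel c t n m) = ENNReal.ofReal (Real.exp (t * c)) := by
  rw [← ENNReal.ofReal_tsum_of_nonneg (sKernel_nonneg ht n) (hasSum_sKernel ht n).summable,
    (hasSum_sKernel ht n).tsum_eq]

theorem tsum_ofReal_sKernel' {c t : ℝ} (ht : 0 ≤ t) (m : ℕ) :
    ∑' n, ENNReal.ofReal (sKernel c t n m) = ENNReal.ofReal (Real.exp (-(t * (1 - c)))) := by
  rw [← sum_sKernel c t m, ENNReal.ofReal_sum_of_nonneg fun n _ => sKernel_nonneg ht n m]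
  refine tsum_eq_sum fun n hn => ?_
  rw [sKernel_eq_zero (by simpa using hn), ENNReal.ofReal_zero]

theorem enorm_semigroupS_le (p : ℝ≥0∞) {t : ℝ} (ht : 0 ≤ t) (f : ℕ → ℂ) (n : ℕ) :
    ‖semigroupS p t f n‖ₑ ≤ ∑' m, ENNReal.ofReal (sKernel (1 / p).toReal t n m) * ‖f m‖ₑ := by
  rw [semigroupS_eq_tsum]
  refine enorm_tsum_le_tsum_enorm.trans_eq (tsum_congr fun m => ?_)
  rw [enorm_mul, ← ofReal_norm (_ : ℂ), norm_sKernel ht]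

/-- Hölder's inequality for the measure with weights `w`, in the form used for a Schur test. -/
theorem tsum_rpow_le_weight_mul {P : ℝ} (hP : 1 ≤ P) (w f : ℕ → ℝ≥0∞) :
    (∑' m, w m * f m) ^ P ≤ (∑' m, w m) ^ (P - 1) * ∑' m, w m * f m ^ P := by
  have hP0 : 0 < P := zero_lt_one.trans_le hP
  have h1 : ∑' m, w m * f m ≤ (∑' m, w m) ^ (1 - P⁻¹) * (∑' m, w m * f m ^ P) ^ P⁻¹ := by
    rw [ENNReal.tsum_eq_iSup_sum]
    refine iSup_le fun s => (ENNReal.inner_le_weight_mul_Lp_of_nonneg s hP w f).trans ?_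
    have : 0 ≤ 1 - P⁻¹ := sub_nonneg.2 (inv_le_one_of_one_le₀ hP)
    gcongr <;> exact ENNReal.sum_le_tsum s
  refine (ENNReal.rpow_le_rpow h1 hP0.le).trans_eq ?_
  rw [ENNReal.mul_rpow_of_nonneg _ _ hP0.le, ← ENNReal.rpow_mul, ← ENNReal.rpow_mul,
    inv_mul_cancel₀ hP0.ne', ENNReal.rpow_one, sub_mul, one_mul, inv_mul_cancel₀ hP0.ne']

/-- `S_p(t)` is a contraction of `ℓ^p`. -/
theorem seqNorm_semigroupS_le {p : ℝ≥0∞} (hp : 1 ≤ p) {t : ℝ} (ht : 0 ≤ t) (f : ℕ → ℂ) :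
    seqNorm p (semigroupS p t f) ≤ seqNorm p f := by
  by_cases hp' : p = ∞
  · subst hp'
    simp only [seqNorm, eLpNorm_exponent_top, eLpNormEssSup_count]
    refine iSup_le fun n => (enorm_semigroupS_le _ ht f n).trans ?_
    calc _ ≤ ∑' m, ENNReal.ofReal (sKernel (1 / ∞ : ℝ≥0∞).toReal t n m) * ⨆ a, ‖f a‖ₑ :=
          ENNReal.tsum_le_tsum fun m => mul_le_mul_right (le_iSup (fun a => ‖f a‖ₑ) m) _
      _ = _ := by rw [ENNReal.tsum_mul_right, tsum_ofReal_sKernel ht]; simp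
  have hP1 := one_le_toReal hp hp'
  have hP := zero_lt_one.trans_le hP1
  rw [seqNorm_eq_tsum hp hp', seqNorm_eq_tsum hp hp']
  refine ENNReal.rpow_le_rpow ?_ (by positivity)
  set c := (1 / p).toReal with hc
  set w : ℕ → ℕ → ℝ≥0∞ := fun n m => ENNReal.ofReal (sKernel c t n m)
  calc ∑' n, ‖semigroupS p t f n‖ₑ ^ p.toReal
      ≤ ∑' n, (∑' m, w n m * ‖f m‖ₑ) ^ p.toReal :=
        ENNReal.tsum_le_tsum fun n => ENNReal.rpow_le_rpow (enorm_semigroupS_le p ht f n) hP.le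
    _ ≤ ∑' n, (∑' m, w n m) ^ (p.toReal - 1) * ∑' m, w n m * ‖f m‖ₑ ^ p.toReal :=
        ENNReal.tsum_le_tsum fun n => tsum_rpow_le_weight_mul hP1 _ _
    _ = ENNReal.ofReal (Real.exp (t * c)) ^ (p.toReal - 1) *
          ∑' n, ∑' m, w n m * ‖f m‖ₑ ^ p.toReal := by
        simp only [w, tsum_ofReal_sKernel ht, ENNReal.tsum_mul_left]
    _ = ENNReal.ofReal (Real.exp (t * c)) ^ (p.toReal - 1) *
          (ENNReal.ofReal (Real.exp (-(t * (1 - c)))) * ∑' m, ‖f m‖ₑ ^ p.toReal) := by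
        rw [ENNReal.tsum_comm]
        simp only [w, ENNReal.tsum_mul_right, tsum_ofReal_sKernel' ht, ENNReal.tsum_mul_left]
    _ = _ := by
        rw [← mul_assoc, ENNReal.ofReal_rpow_of_pos (Real.exp_pos _), ← Real.exp_mul,
          ← ENNReal.ofReal_mul (Real.exp_pos _).le, ← Real.exp_add]
        -- Row sums contribute `e^{tc(P-1)}` and column sums `e^{-t(1-c)}`; the factors cancel
        -- exactly for `c = 1/p`.
        have : c * p.toReal = 1 := by
          rw [hc, one_div, ENNReal.toReal_inv, inv_mul_cancel₀ hP.ne']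
        rw [show t * c * (p.toReal - 1) + -(t * (1 - c)) = t * (c * p.toReal - 1) by ring, this]
        simp

theorem one_sub_toReal_nonneg {p : ℝ≥0∞} (hp : 1 ≤ p) : 0 ≤ 1 - (1 / p).toReal := by
  have : 1 / p ≤ 1 := ENNReal.div_le_of_le_mul (by simpa using hp)
  simpa using ENNReal.toReal_mono ENNReal.one_ne_top this

/-! ### Dissipativity and the resolvent on `ℓ^p` -/

theorem semigroupS_zero (p : ℝ≥0∞) (f : ℕ → ℂ) : semigroupS p 0 f = f := by
  ext n
  rw [semigroupS, tsum_eq_single 0]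
  · simp
  · intro j hj
    simp [hj]

theorem genB_sub (p : ℝ≥0∞) (f g : ℕ → ℂ) : genB p (f - g) = genB p f - genB p g := by
  ext n
  simp only [genB, Pi.sub_apply]
  ring

theorem tendsto_semigroupS {ι : Type*} {l : Filter ι} (p : ℝ≥0∞) {t : ℝ} (ht : 0 ≤ t)
    {u : ι → ℕ → ℂ} {f : ℕ → ℂ} {C : ℝ} (hC : ∀ i n, ‖u i n‖ ≤ C)
    (h : ∀ n, Tendsto (fun i => u i n) l (𝓝 (f n))) (n : ℕ) :
    Tendsto (fun i => semigroupS p t (u i) n) l (𝓝 (semigroupS p t f n)) := by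
  simp only [semigroupS_eq_tsum]
  refine tendsto_tsum_of_dominated_convergence
    ((hasSum_sKernel (c := (1 / p).toReal) ht n).summable.mul_right C)
    (fun m => (h m).const_mul _) (.of_forall ?_)
  intro i m
  rw [norm_mul, norm_sKernel ht]
  exact mul_le_mul_of_nonneg_left (hC i m) (sKernel_nonneg ht n m)

/-- `S_p(t)` and `genB` preserve support below `N`, so only finitely many coordinates are involved.
-/
theorem VanishesFrom.tendsto_seqNorm_diffQuotient_sub {p : ℝ≥0∞} (hp : 1 ≤ p) {N : ℕ}
    {u : ℕ → ℂ} (hu : VanishesFrom N u) :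
    Tendsto (fun t : ℝ => seqNorm p (diffQuotient (SobolevLebesgue.semigroupS p) u t -
      SobolevLebesgue.genB p u)) (𝓝[>] 0) (𝓝 0) := by
  have h0 : Tendsto (fun t : ℝ => ∑ n ∈ Finset.range N,
      ‖(diffQuotient (SobolevLebesgue.semigroupS p) u t - SobolevLebesgue.genB p u) n‖ₑ)
        (𝓝[>] 0) (𝓝 0) := by
    have h1 : (0 : ℝ≥0∞) = ∑ n ∈ Finset.range N, ‖(0 : ℂ)‖ₑ := by simp
    rw [h1]
    refine tendsto_finsetSum _ fun n _ => ?_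
    refine (continuous_enorm.tendsto (0 : ℂ)).comp ?_
    simpa using (tendsto_diffQuotient_semigroupS p hu.bounded.tame n).sub_const
      (SobolevLebesgue.genB p u n)
  refine tendsto_of_tendsto_of_tendsto_of_le_of_le tendsto_const_nhds h0 (fun t => zero_le)
    fun t => VanishesFrom.seqNorm_le hp ?_
  exact (((hu.semigroupS p t).sub hu).smul _).sub (hu.genB p)

theorem smul_diffQuotient (U : ℝ → (ℕ → ℂ) → (ℕ → ℂ)) (f : ℕ → ℂ) {t : ℝ} (ht : t ≠ 0) :
    (t : ℂ) • diffQuotient U f t = U t f - f := by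
  rw [diffQuotient, smul_smul, mul_inv_cancel₀ (by exact_mod_cast ht), one_smul]

theorem enorm_ofReal_of_nonneg {t : ℝ} (ht : 0 ≤ t) : ‖(t : ℂ)‖ₑ = ENNReal.ofReal t := by
  rw [← ofReal_norm, Complex.norm_of_nonneg ht]

/-- Telescoping with the semigroup law, each step being a contraction. -/
theorem seqNorm_semigroupS_nat_mul_sub_le {p : ℝ≥0∞} (hp : 1 ≤ p) {f : ℕ → ℂ}
    (hf : BoundedSeq f) {s : ℝ} (hs : 0 ≤ s) (k : ℕ) :
    seqNorm p (semigroupS p (k * s) f - f) ≤ k * seqNorm p (semigroupS p s f - f) := by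
  induction k with
  | zero => simp [semigroupS_zero]
  | succ k ih =>
    have hks : 0 ≤ k * s := by positivity
    have h1 : semigroupS p ((k + 1 : ℕ) * s) f - f =
        semigroupS p (k * s) (semigroupS p s f - f) + (semigroupS p (k * s) f - f) := by
      rw [semigroupS_sub (hf.semigroupS p hs).tame hf.tame p hks,
        semigroupS_semigroupS p hks hs hf, show ((k + 1 : ℕ) : ℝ) * s = k * s + s by
          push_cast; ring]
      abel
    rw [h1]
    refine (seqNorm_add_le hp _ _).trans ?_
    rw [Nat.cast_succ, add_mul, one_mul, add_comm]
    exact add_le_add ih (seqNorm_semigroupS_le hp hks _)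

/-- Divide `[0, t]` into `k` equal pieces, telescope and let `k → ∞`. This replaces the formula
`S(t)u - u = ∫₀ᵗ S(s)Bu ds`. -/
theorem VanishesFrom.seqNorm_semigroupS_sub_le {p : ℝ≥0∞} (hp : 1 ≤ p) {N : ℕ} {u : ℕ → ℂ}
    (hu : VanishesFrom N u) {t : ℝ} (ht : 0 < t) :
    seqNorm p (SobolevLebesgue.semigroupS p t u - u) ≤
      ENNReal.ofReal t * seqNorm p (SobolevLebesgue.genB p u) := by
  set B := SobolevLebesgue.genB p u
  have h1 : ∀ k : ℕ, k ≠ 0 → seqNorm p (SobolevLebesgue.semigroupS p t u - u) ≤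
      ENNReal.ofReal t * (seqNorm p (diffQuotient (SobolevLebesgue.semigroupS p) u (t / k) - B) +
        seqNorm p B) := by
    intro k hk
    have hk' : (0 : ℝ) < k := by exact_mod_cast Nat.pos_of_ne_zero hk
    have hs : 0 < t / k := by positivity
    have h2 := seqNorm_semigroupS_nat_mul_sub_le hp hu.bounded hs.le k
    rw [mul_div_cancel₀ _ hk'.ne', ← smul_diffQuotient _ u hs.ne', seqNorm_smul,
      enorm_ofReal_of_nonneg hs.le, ← mul_assoc, ← ENNReal.ofReal_natCast k,
      ← ENNReal.ofReal_mul hk'.le, mul_div_cancel₀ _ hk'.ne'] at h2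
    refine h2.trans (mul_le_mul_right ?_ _)
    simpa using seqNorm_add_le hp
      (diffQuotient (SobolevLebesgue.semigroupS p) u (t / k) - B) B
  have h3 : Tendsto (fun k : ℕ => t / k) atTop (𝓝[>] 0) := by
    refine tendsto_nhdsWithin_iff.2 ⟨tendsto_const_div_atTop_nhds_zero_nat t, ?_⟩
    filter_upwards [eventually_gt_atTop 0] with k hk
    exact div_pos ht (by exact_mod_cast hk)
  have h4 := ENNReal.Tendsto.const_mul (a := ENNReal.ofReal t)
    (((hu.tendsto_seqNorm_diffQuotient_sub hp).comp h3).add_const (seqNorm p B))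
    (Or.inr ENNReal.ofReal_ne_top)
  rw [zero_add] at h4
  refine ge_of_tendsto h4 ?_
  filter_upwards [eventually_ne_atTop 0] with k hk using h1 k hk

/-- Dissipativity of the generator of `S_p(t)` on finitely supported sequences. -/
theorem VanishesFrom.mul_seqNorm_le {p : ℝ≥0∞} (hp : 1 ≤ p) {N : ℕ} {u : ℕ → ℂ}
    (hu : VanishesFrom N u) {z : ℂ} (hz : 0 < z.re) :
    ENNReal.ofReal z.re * seqNorm p u ≤ seqNorm p (z • u - SobolevLebesgue.genB p u) := by
  set B := SobolevLebesgue.genB p u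
  set h := z • u - B
  have h1 : ∀ t : ℝ, 0 < t → ENNReal.ofReal z.re * seqNorm p u ≤ seqNorm p h +
      seqNorm p (diffQuotient (SobolevLebesgue.semigroupS p) u t - B) := by
    intro t ht
    set e := diffQuotient (SobolevLebesgue.semigroupS p) u t - B with he
    -- By contractivity this gives `(1 + t Re z)‖u‖ ≤ ‖u‖ + t(‖h‖ + ‖e‖)`; cancel `‖u‖`, divide by
    -- `t`, and let `t → 0`, where `e → 0`.
    have h2 : (1 + t * z) • u = SobolevLebesgue.semigroupS p t u + (t : ℂ) • (h - e) := by
      have h3 : SobolevLebesgue.semigroupS p t u = u + (t : ℂ) • (B + e) := by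
        rw [he, add_sub_cancel, smul_diffQuotient _ u ht.ne', add_sub_cancel]
      rw [h3]
      ext n
      simp only [h, Pi.smul_apply, Pi.add_apply, Pi.sub_apply, smul_eq_mul]
      ring
    have h4 : ENNReal.ofReal (1 + t * z.re) * seqNorm p u ≤
        seqNorm p u + ENNReal.ofReal t * (seqNorm p h + seqNorm p e) := by
      calc _ ≤ ‖1 + t * z‖ₑ * seqNorm p u := by
            gcongr
            rw [← ofReal_norm]
            refine ENNReal.ofReal_le_ofReal ((le_abs_self _).trans ?_)
            simpa using Complex.abs_re_le_norm (1 + t * z)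
        _ ≤ _ := by
            rw [← seqNorm_smul, h2]
            refine (seqNorm_add_le hp _ _).trans (add_le_add (seqNorm_semigroupS_le hp ht.le u) ?_)
            rw [seqNorm_smul, enorm_ofReal_of_nonneg ht.le]
            gcongr
            exact seqNorm_sub_le hp h e
    have hu' := (hu.seqNorm_lt_top hp).ne
    rw [ENNReal.ofReal_add zero_le_one (by positivity), ENNReal.ofReal_one, add_mul, one_mul,
      ENNReal.add_le_add_iff_left hu', ENNReal.ofReal_mul ht.le, mul_assoc] at h4
    exact (ENNReal.mul_le_mul_iff_right (ENNReal.ofReal_pos.2 ht).ne' ENNReal.ofReal_ne_top).1 h4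
  have h4 := (hu.tendsto_seqNorm_diffQuotient_sub hp).const_add (seqNorm p h)
  rw [add_zero] at h4
  refine ge_of_tendsto h4 ?_
  filter_upwards [self_mem_nhdsWithin] with t ht using h1 t ht

/-- Back substitution for the upper triangular system `(z - B) u = h`. -/
theorem VanishesFrom.exists_sub_genB_eq {p : ℝ≥0∞} (hp : 1 ≤ p) {z : ℂ} (hz : 0 < z.re) {N : ℕ}
    {h : ℕ → ℂ} (hh : VanishesFrom N h) :
    ∃ u, VanishesFrom N u ∧ z • u - SobolevLebesgue.genB p u = h := by
  set a : ℕ → ℂ := fun n => z + (1 - (1 / p).toReal + n) with ha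
  have ha0 : ∀ n, a n ≠ 0 := by
    intro n h0
    have h1 := congrArg Complex.re h0
    simp only [ha, Complex.add_re, Complex.sub_re, Complex.one_re, Complex.ofReal_re,
      Complex.natCast_re, Complex.zero_re] at h1
    have := one_sub_toReal_nonneg hp
    have : (0 : ℝ) ≤ n := by positivity
    linarith
  -- `v k` is the entry at index `N - k`, computed from the top down; `v 0 = 0` supplies all entries
  -- from `N` on.
  let v : ℕ → ℂ := Nat.rec 0 fun k w => (h (N - 1 - k) + ((N - 1 - k : ℕ) + 1) * w) / a (N - 1 - k)
  refine ⟨fun n => v (N - n), fun n hn => ?_, ?_⟩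
  · simp only [Nat.sub_eq_zero_of_le hn]; rfl
  · ext n
    simp only [SobolevLebesgue.genB, Pi.sub_apply, Pi.smul_apply, smul_eq_mul]
    rcases lt_or_ge n N with hn | hn
    · have h1 : v (N - n) = (h n + (n + 1) * v (N - (n + 1))) / a n := by
        rw [show N - n = (N - (n + 1)) + 1 by omega]
        change (h (N - 1 - (N - (n + 1))) + ((N - 1 - (N - (n + 1)) : ℕ) + 1) * v (N - (n + 1))) /
          a (N - 1 - (N - (n + 1))) = _
        rw [show N - 1 - (N - (n + 1)) = n by omega]
      rw [eq_div_iff (ha0 n)] at h1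
      simp only [ha] at h1
      linear_combination h1
    · rw [Nat.sub_eq_zero_of_le hn, Nat.sub_eq_zero_of_le (by omega : N ≤ n + 1), hh n hn]
      simp [v]

/-- The resolvent of the generator of `S_p(t)` on `ℓ^p`, for `Re z > 0`. -/
theorem exists_sub_genB_eq {p : ℝ≥0∞} (hp : 1 ≤ p) {z : ℂ} (hz : 0 < z.re) {h : ℕ → ℂ}
    (hh : seqNorm p h < ∞) : ∃ f, z • f - genB p f = h ∧
      seqNorm p f ≤ ENNReal.ofReal (z.re)⁻¹ * seqNorm p h ∧
      ∀ t : ℝ, 0 < t → seqNorm p (semigroupS p t f - f) ≤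
        ENNReal.ofReal t * ((‖z‖ₑ * ENNReal.ofReal (z.re)⁻¹ + 1) * seqNorm p h) := by
  choose u hu hu' using fun k => (truncate_vanishesFrom k h).exists_sub_genB_eq hp hz
  set b := ENNReal.ofReal (z.re)⁻¹ * seqNorm p h with hb
  have hbu : ∀ k, seqNorm p (u k) ≤ b := by
    intro k
    have h1 := (hu k).mul_seqNorm_le hp hz
    rw [hu' k] at h1
    have h2 := mul_le_mul_right (h1.trans (seqNorm_truncate_le p k h)) (ENNReal.ofReal (z.re)⁻¹)
    rwa [← mul_assoc, ← ENNReal.ofReal_mul (by positivity), inv_mul_cancel₀ hz.ne',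
      ENNReal.ofReal_one, one_mul] at h2
  have hb' : b < ∞ := ENNReal.mul_lt_top ENNReal.ofReal_lt_top hh
  have hun : ∀ k n, ‖u k n‖ ≤ b.toReal := by
    intro k n
    have := ENNReal.toReal_mono hb'.ne
      ((enorm_le_eLpNorm_count (u k) n (zero_lt_one.trans_le hp).ne').trans (hbu k))
    simpa using this
  -- The solutions for truncated data are uniformly bounded, so by Tychonoff a subsequence converges
  -- coordinatewise. That suffices: `genB` involves two coordinates at a time, and the norm bounds
  -- pass to the limit. The argument includes `p = ∞`.
  have hK : IsCompact (Set.univ.pi fun _ : ℕ => Metric.closedBall (0 : ℂ) b.toReal) :=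
    isCompact_univ_pi fun _ => isCompact_closedBall _ _
  obtain ⟨f, -, φ, hφ, hlim⟩ := hK.tendsto_subseq (x := u) fun k n _ => by simpa using hun k n
  have hlim' : ∀ n, Tendsto (fun k => u (φ k) n) atTop (𝓝 (f n)) := tendsto_pi_nhds.1 hlim
  refine ⟨f, ?_, seqNorm_le_of_tendsto (fun k => hbu (φ k)) hlim', fun t ht => ?_⟩
  · ext n
    have h1 : Tendsto (fun k => (z • u (φ k) - genB p (u (φ k))) n) atTop
        (𝓝 ((z • f - genB p f) n)) := by
      simp only [genB, Pi.sub_apply, Pi.smul_apply, smul_eq_mul]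
      exact ((hlim' n).const_mul _).sub (((hlim' n).const_mul _).add ((hlim' (n + 1)).const_mul _))
    simp only [hu'] at h1
    exact tendsto_nhds_unique h1 ((tendsto_truncate h n).comp hφ.tendsto_atTop)
  · refine seqNorm_le_of_tendsto (u := fun k => semigroupS p t (u (φ k)) - u (φ k)) (fun k => ?_)
      fun n => (tendsto_semigroupS p ht.le (fun k => hun (φ k)) hlim' n).sub (hlim' n)
    refine ((hu (φ k)).seqNorm_semigroupS_sub_le hp ht).trans (mul_le_mul_right ?_ _)
    have h1 : genB p (u (φ k)) = z • u (φ k) - truncate (φ k) h := by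
      rw [← hu']; abel
    rw [h1, add_mul, one_mul, mul_assoc]
    refine (seqNorm_sub_le hp _ _).trans (add_le_add ?_ (seqNorm_truncate_le p _ h))
    rw [seqNorm_smul]
    exact mul_le_mul_right (hbu (φ k)) _

/-! ### Which Cesaro sequences lie in `ℓ^p` -/

theorem seqNorm_lt_top_iff_summable {p : ℝ≥0∞} (hp : 1 ≤ p) (hp' : p ≠ ∞) {f : ℕ → ℂ} :
    seqNorm p f < ∞ ↔ Summable fun n => ‖f n‖ ^ p.toReal := by
  have hP := zero_lt_one.trans_le (one_le_toReal hp hp')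
  rw [seqNorm_eq_tsum hp hp', ENNReal.rpow_lt_top_iff_of_pos (by positivity)]
  have h1 : ∀ n, ‖f n‖ₑ ^ p.toReal = ENNReal.ofReal (‖f n‖ ^ p.toReal) := fun n => by
    rw [← ofReal_norm, ENNReal.ofReal_rpow_of_nonneg (norm_nonneg _) hP.le]
  simp only [h1, lt_top_iff_ne_top]
  refine ⟨fun h => ?_, fun h => h.tsum_ofReal_ne_top⟩
  refine (ENNReal.summable_toReal h).congr fun n => ENNReal.toReal_ofReal (by positivity)

theorem seqNorm_top_lt_top_iff {f : ℕ → ℂ} : seqNorm ∞ f < ∞ ↔ BoundedSeq f := by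
  refine ⟨.of_seqNorm_lt_top le_top, fun ⟨C, hC⟩ => ?_⟩
  simp only [seqNorm, eLpNorm_exponent_top, eLpNormEssSup_count]
  refine (iSup_le fun n => ?_).trans_lt (ENNReal.ofReal_lt_top (r := C))
  rw [← ofReal_norm]
  exact ENNReal.ofReal_le_ofReal (hC n)

theorem cesaroNumber_re_sub_one (p : ℝ≥0∞) (z : ℂ) :
    (z + 1 - ((1 / p).toReal : ℂ)).re - 1 = z.re - (1 / p).toReal := by
  simp only [Complex.sub_re, Complex.add_re, Complex.one_re, Complex.ofReal_re]
  ring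

theorem toReal_one_div_mul {p : ℝ≥0∞} (hp : 1 ≤ p) (hp' : p ≠ ∞) :
    (1 / p).toReal * p.toReal = 1 := by
  have hP := zero_lt_one.trans_le (one_le_toReal hp hp')
  rw [one_div, ENNReal.toReal_inv, inv_mul_cancel₀ hP.ne']

theorem seqNorm_cesaroNumber_top_lt_top {z : ℂ} (hz : z.re ≤ 0) :
    seqNorm ∞ (cesaroNumber (z + 1 - ((1 / ∞ : ℝ≥0∞).toReal : ℂ))) < ∞ :=
  seqNorm_top_lt_top_iff.2 (bounded_cesaroNumber (by simpa using hz))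

theorem seqNorm_cesaroNumber_lt_top {p : ℝ≥0∞} (hp : 1 ≤ p) {z : ℂ} (hz : z.re < 0) :
    seqNorm p (cesaroNumber (z + 1 - ((1 / p).toReal : ℂ))) < ∞ := by
  by_cases hp' : p = ∞
  · subst hp'
    exact seqNorm_cesaroNumber_top_lt_top hz.le
  have hP := zero_lt_one.trans_le (one_le_toReal hp hp')
  rw [seqNorm_lt_top_iff_summable hp hp']
  refine summable_norm_cesaroNumber_rpow hP ?_
  rw [cesaroNumber_re_sub_one, sub_mul, toReal_one_div_mul hp hp']
  nlinarith

theorem seqNorm_one_cesaroNumber_lt_top :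
    seqNorm 1 (cesaroNumber (0 + 1 - ((1 / 1 : ℝ≥0∞).toReal : ℂ))) < ∞ := by
  have h : VanishesFrom 1 (cesaroNumber (0 + 1 - ((1 / 1 : ℝ≥0∞).toReal : ℂ))) := fun n hn => by
    simp [cesaroNumber_zero_left, Nat.one_le_iff_ne_zero.1 hn]
  exact h.seqNorm_lt_top le_rfl

theorem re_neg_of_seqNorm_cesaroNumber_lt_top {p : ℝ≥0∞} (hp : 1 ≤ p) (hp' : p ≠ ∞) {z : ℂ}
    (h : seqNorm p (cesaroNumber (z + 1 - ((1 / p).toReal : ℂ))) < ∞) :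
    z.re < 0 ∨ p = 1 ∧ z = 0 := by
  by_contra! hcon
  obtain ⟨hz, hz1⟩ := hcon
  have hP := zero_lt_one.trans_le (one_le_toReal hp hp')
  have hc := one_sub_toReal_nonneg hp
  -- With `Re z ≥ 0` and `1 - 1/p ≥ 0`, the sequence can terminate only for `p = 1`, `z = 0`, which
  -- is excluded here.
  have ha : ∀ m : ℕ, z + 1 - ((1 / p).toReal : ℂ) ≠ -m := by
    intro m hm
    have h1 := congrArg Complex.re hm
    simp only [Complex.sub_re, Complex.add_re, Complex.one_re, Complex.ofReal_re, Complex.neg_re,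
      Complex.natCast_re] at h1
    have hm0 : (0 : ℝ) ≤ m := by positivity
    have hm1 : (m : ℝ) = 0 := by linarith
    have hc1 : (1 / p).toReal = 1 := by linarith
    have h2 := toReal_one_div_mul hp hp'
    rw [hc1, one_mul] at h2
    refine hz1 ?_ ?_
    · rw [← ENNReal.ofReal_toReal hp', h2, ENNReal.ofReal_one]
    · rw [hc1] at hm
      have : (m : ℂ) = 0 := by exact_mod_cast hm1
      simpa [this] using hm
  obtain ⟨c, hc0, hlow⟩ := exists_le_norm_cesaroNumber ha
  rw [seqNorm_lt_top_iff_summable hp hp'] at h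
  rw [cesaroNumber_re_sub_one] at hlow
  -- The exponent is `p Re z - 1 ≥ -1`, contradicting summability.
  have h1 : Summable fun n : ℕ => c ^ p.toReal * (n : ℝ) ^ ((z.re - (1 / p).toReal) * p.toReal) := by
    refine Summable.of_norm_bounded_eventually_nat h ?_
    filter_upwards [hlow] with n hn
    rw [Real.norm_of_nonneg (by positivity), Real.rpow_mul (by positivity),
      ← Real.mul_rpow hc0.le (by positivity)]
    exact Real.rpow_le_rpow (by positivity) hn hP.le
  rw [summable_mul_left_iff (by positivity), Real.summable_nat_rpow, sub_mul,
    toReal_one_div_mul hp hp'] at h1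
  nlinarith

theorem re_nonpos_of_seqNorm_cesaroNumber_lt_top {p : ℝ≥0∞} (hp : 1 ≤ p) {z : ℂ}
    (h : seqNorm p (cesaroNumber (z + 1 - ((1 / p).toReal : ℂ))) < ∞) : z.re ≤ 0 := by
  by_cases hp' : p = ∞
  · subst hp'
    by_contra! hz
    obtain ⟨C, hC⟩ := seqNorm_top_lt_top_iff.1 h
    simp only [ENNReal.div_top, ENNReal.toReal_zero, Complex.ofReal_zero, sub_zero] at hC
    obtain ⟨c, hc0, hlow⟩ := exists_le_norm_cesaroNumber (a := z + 1) fun m hm => by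
      have h1 := congrArg Complex.re hm
      simp only [Complex.add_re, Complex.one_re, Complex.neg_re, Complex.natCast_re] at h1
      have hm0 : (0 : ℝ) ≤ m := by positivity
      linarith
    have h1 : Tendsto (fun n : ℕ => c * (n : ℝ) ^ ((z + 1).re - 1)) atTop atTop := by
      refine Tendsto.const_mul_atTop hc0 ((tendsto_rpow_atTop ?_).comp tendsto_natCast_atTop_atTop)
      simpa using hz
    obtain ⟨n, h2, h3⟩ := (hlow.and (h1.eventually_gt_atTop C)).exists
    exact absurd (hC n) (not_le.2 (h3.trans_le h2))
  · rcases re_neg_of_seqNorm_cesaroNumber_lt_top hp hp' h with h1 | ⟨-, rfl⟩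
    · exact h1.le
    · simp

theorem seqNorm_cesaroNumber_lt_top_of_genB_eq {p : ℝ≥0∞} {z : ℂ} {f : ℕ → ℂ} (hf0 : f ≠ 0)
    (hf : seqNorm p f < ∞) (h : genB p f = z • f) :
    seqNorm p (cesaroNumber (z + 1 - ((1 / p).toReal : ℂ))) < ∞ := by
  have h1 := eq_cesaroNumber_of_genB_eq (p := p) (z := z) (f := f) fun n => congrFun h n
  have h2 : f 0 ≠ 0 := fun h2 => hf0 (by rw [h1, h2, zero_smul])
  rw [h1, seqNorm_smul] at hf
  by_contra h3
  rw [not_lt, top_le_iff] at h3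
  rw [h3, ENNReal.mul_top (by simpa using h2)] at hf
  exact lt_irrefl _ hf

theorem eq_zero_of_genB_eq {p : ℝ≥0∞} (hp : 1 ≤ p) {z : ℂ} (hz : 0 < z.re) {f : ℕ → ℂ}
    (hf : seqNorm p f < ∞) (h : genB p f = z • f) : f = 0 := by
  by_contra hf0
  exact absurd (re_nonpos_of_seqNorm_cesaroNumber_lt_top hp
    (seqNorm_cesaroNumber_lt_top_of_genB_eq hf0 hf h)) (not_le.2 hz)

/-! ### Norm convergence of the difference quotients for `p < ∞` -/

/-- For `p < ∞` the sequences `(z - B)⁻¹ h` are in the domain of the generator. -/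
theorem tendsto_seqNorm_diffQuotient_sub {p : ℝ≥0∞} (hp : 1 ≤ p) (hp' : p ≠ ∞) {z : ℂ}
    (hz : 0 < z.re) {f h : ℕ → ℂ} (hf : seqNorm p f < ∞) (hh : seqNorm p h < ∞)
    (hfh : z • f - genB p f = h) :
    Tendsto (fun t : ℝ => seqNorm p (diffQuotient (semigroupS p) f t - genB p f))
      (𝓝[>] 0) (𝓝 0) := by
  set K : ℝ≥0∞ := ‖z‖ₑ * ENNReal.ofReal (z.re)⁻¹ + 1 with hK
  have hKtop : K ≠ ∞ := by finiteness
  -- Here `u` solves the equation for the truncation of `h` and `v` for its tail. Convergence is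
  -- known for `u`, while `genB p v` and the quotients of `v` are small uniformly in `t`.
  have hsplit : ∀ k : ℕ, ∃ u v : ℕ → ℂ, VanishesFrom k u ∧ f = u + v ∧ BoundedSeq v ∧
      seqNorm p (genB p v) ≤ K * seqNorm p (h - truncate k h) ∧
      ∀ t : ℝ, 0 < t → seqNorm p (semigroupS p t v - v) ≤
        ENNReal.ofReal t * (K * seqNorm p (h - truncate k h)) := by
    intro k
    obtain ⟨u, hu, hu'⟩ := (truncate_vanishesFrom k h).exists_sub_genB_eq hp hz
    have hk : seqNorm p (h - truncate k h) < ∞ := (seqNorm_sub_le hp _ _).trans_lt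
      (ENNReal.add_lt_top.2 ⟨hh, (seqNorm_truncate_le p k h).trans_lt hh⟩)
    obtain ⟨v, hv, hvn, hvt⟩ := exists_sub_genB_eq hp hz hk
    have hvfin : seqNorm p v < ∞ :=
      hvn.trans_lt (ENNReal.mul_lt_top ENNReal.ofReal_lt_top hk)
    -- The difference is an `ℓ^p` eigenvector for an eigenvalue with positive real part, hence zero.
    have h0 : f - u - v = 0 := by
      refine eq_zero_of_genB_eq hp hz ?_ ?_
      · exact (seqNorm_sub_le hp _ _).trans_lt (ENNReal.add_lt_top.2
          ⟨(seqNorm_sub_le hp _ _).trans_lt (ENNReal.add_lt_top.2 ⟨hf, hu.seqNorm_lt_top hp⟩),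
            hvfin⟩)
      · have h1 : genB p f = z • f - h := by rw [← hfh]; abel
        have h2 : genB p u = z • u - truncate k h := by rw [← hu']; abel
        have h3 : genB p v = z • v - (h - truncate k h) := by rw [← hv]; abel
        rw [genB_sub, genB_sub, h1, h2, h3, smul_sub, smul_sub]
        abel
    refine ⟨u, v, hu, ?_, .of_seqNorm_lt_top hp hvfin, ?_, hvt⟩
    · rw [sub_sub, sub_eq_zero] at h0
      exact h0
    · have h3 : genB p v = z • v - (h - truncate k h) := by rw [← hv]; abel
      rw [h3, hK, add_mul, one_mul, mul_assoc]
      refine (seqNorm_sub_le hp _ _).trans (add_le_add ?_ le_rfl)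
      rw [seqNorm_smul]
      exact mul_le_mul_right hvn _
  rw [ENNReal.tendsto_nhds_zero]
  intro ε hε
  have hlim : Tendsto (fun k => K * seqNorm p (h - truncate k h)) atTop (𝓝 0) := by
    simpa using ENNReal.Tendsto.const_mul (tendsto_seqNorm_sub_truncate hp hp' hh)
      (Or.inr hKtop)
  have hε3 : 0 < ε / 3 := ENNReal.div_pos hε.ne' (by norm_num)
  obtain ⟨k, hk⟩ := ((ENNReal.tendsto_nhds_zero.1 hlim) (ε / 3) hε3).exists
  obtain ⟨u, v, hu, rfl, hvb, hBv, hvt⟩ := hsplit k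
  filter_upwards [self_mem_nhdsWithin,
    (ENNReal.tendsto_nhds_zero.1 (hu.tendsto_seqNorm_diffQuotient_sub hp)) (ε / 3) hε3]
    with t (ht : 0 < t) htu
  have h1 : seqNorm p (diffQuotient (semigroupS p) v t) ≤ ε / 3 := by
    have h2 := hvt t ht
    rw [← smul_diffQuotient (semigroupS p) v ht.ne', seqNorm_smul, enorm_ofReal_of_nonneg ht.le] at h2
    exact ((ENNReal.mul_le_mul_iff_right (ENNReal.ofReal_pos.2 ht).ne' ENNReal.ofReal_ne_top).1
      h2).trans hk
  have h2 : diffQuotient (semigroupS p) (u + v) t - genB p (u + v) =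
      (diffQuotient (semigroupS p) u t - genB p u) + diffQuotient (semigroupS p) v t -
        genB p v := by
    have h3 : semigroupS p t u = semigroupS p t (u + v) - semigroupS p t v := by
      have h4 : Tame (u + v) := (BoundedSeq.of_seqNorm_lt_top hp hf).tame
      rw [← semigroupS_sub h4 hvb.tame p ht.le, add_sub_cancel_right]
    have h5 : genB p u = genB p (u + v) - genB p v := by
      rw [← genB_sub, add_sub_cancel_right]
    rw [h5]
    simp only [diffQuotient, h3]
    rw [← sub_eq_zero]
    ext n
    simp only [Pi.sub_apply, Pi.add_apply, Pi.smul_apply, smul_eq_mul, Pi.zero_apply]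
    ring
  rw [h2]
  calc _ ≤ seqNorm p (diffQuotient (semigroupS p) u t - genB p u) +
        seqNorm p (diffQuotient (semigroupS p) v t) + seqNorm p (genB p v) :=
        (seqNorm_sub_le hp _ _).trans (add_le_add (seqNorm_add_le hp _ _) le_rfl)
    _ ≤ ε / 3 + ε / 3 + ε / 3 := add_le_add (add_le_add htu h1) (hBv.trans hk)
    _ = ε := ENNReal.add_thirds ε

/-! ### Inverting `D^α` for `p < ∞` -/

theorem add_mul_cesaroNumber (a : ℂ) (n : ℕ) :
    (a + n) * cesaroNumber a n = a * cesaroNumber (a + 1) n := by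
  induction n with
  | zero => simp [cesaroNumber_zero_right]
  | succ n ih =>
    have h : (n : ℂ) + 1 ≠ 0 := by exact_mod_cast n.succ_ne_zero
    refine mul_left_cancel₀ h ?_
    push_cast
    linear_combination (a + n + 1) * cesaroNumber_succ a n - a * cesaroNumber_succ (a + 1) n +
      (a + n + 1) * ih

/-- For `j > 0` the ratio is `α / (α + j)`. The constant `1 + α` also covers `j = 0`, where the
ratio is `1`. -/
theorem norm_cesaroNumber_le {α : ℝ} (hα : 0 ≤ α) (j : ℕ) : ‖cesaroNumber (α : ℂ) j‖ ≤
    (1 + α) / (j + 1) * ‖cesaroNumber ((α : ℂ) + 1) j‖ := by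
  cases j with
  | zero => simp [cesaroNumber_zero_right, hα]
  | succ j =>
    have h := congrArg norm (add_mul_cesaroNumber (α : ℂ) (j + 1))
    have h1 : ‖(α : ℂ) + (j + 1 : ℕ)‖ = α + (j + 1) := by
      rw [← Complex.norm_of_nonneg (show 0 ≤ α + (j + 1) by positivity)]; push_cast; rfl
    rw [norm_mul, norm_mul, h1, Complex.norm_of_nonneg hα] at h
    have h2 : (0 : ℝ) < α + (j + 1) := by positivity
    refine le_of_mul_le_mul_left ?_ h2
    rw [h, ← mul_assoc]
    refine mul_le_mul_of_nonneg_right ?_ (norm_nonneg _)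
    rw [← mul_div_assoc, le_div_iff₀ (by positivity)]
    push_cast
    nlinarith [mul_nonneg hα hα, mul_nonneg hα (Nat.cast_nonneg (α := ℝ) j)]

theorem norm_cesaroNumber_div_le {α : ℝ} (hα : 0 ≤ α) (n j : ℕ) :
    ‖cesaroNumber (α : ℂ) j / cesaroNumber ((α : ℂ) + 1) (n + j)‖ ≤ (1 + α) / (j + 1) := by
  have h1 := one_le_norm_cesaroNumber_add_one hα (n + j)
  rw [norm_div, div_le_iff₀ (by linarith)]
  refine (norm_cesaroNumber_le hα j).trans (mul_le_mul_of_nonneg_left ?_ (by positivity))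
  exact norm_cesaroNumber_add_one_mono hα (Nat.le_add_left j n)

theorem seqNorm_inv_lt_top {q : ℝ≥0∞} (hq : 1 < q) (C : ℝ) :
    seqNorm q (fun j => ((C / (j + 1) : ℝ) : ℂ)) < ∞ := by
  have h1 : ∀ j : ℕ, ‖((C / (j + 1) : ℝ) : ℂ)‖ = |C| * (1 / (j + 1)) := fun j => by
    rw [Complex.norm_real, Real.norm_eq_abs, abs_div, abs_of_nonneg (by positivity : (0:ℝ) ≤ j + 1)]
    ring
  by_cases hq' : q = ∞
  · subst hq'
    refine seqNorm_top_lt_top_iff.2 ⟨|C|, fun j => ?_⟩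
    rw [h1]
    refine mul_le_of_le_one_right (abs_nonneg C) ?_
    rw [div_le_one (by positivity)]
    linarith [Nat.cast_nonneg (α := ℝ) j]
  · have hQ : 1 < q.toReal := by simpa using (ENNReal.toReal_lt_toReal ENNReal.one_ne_top hq').2 hq
    rw [seqNorm_lt_top_iff_summable hq.le hq']
    simp only [h1]
    have h2 := (((summable_nat_add_iff 1).2 (Real.summable_one_div_nat_rpow.2 hQ)).mul_left
      (|C| ^ q.toReal))
    refine h2.congr fun j => ?_
    rw [Real.mul_rpow (abs_nonneg _) (by positivity), Real.div_rpow zero_le_one (by positivity),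
      Real.one_rpow]
    push_cast
    rfl

theorem seqNorm_shift_le {p : ℝ≥0∞} (hp : 1 ≤ p) (hp' : p ≠ ∞) (f : ℕ → ℂ) (n : ℕ) :
    seqNorm p (fun j => f (n + j)) ≤ seqNorm p f := by
  rw [seqNorm_eq_tsum hp hp', seqNorm_eq_tsum hp hp']
  exact ENNReal.rpow_le_rpow (ENNReal.tsum_comp_le_tsum_of_injective (add_right_injective n) _)
    (by positivity)

theorem tsum_enorm_mul_le {p q : ℝ≥0∞} [ENNReal.HolderConjugate q p] (φ f : ℕ → ℂ) :
    ∑' j, ‖φ j * f j‖ₑ ≤ seqNorm q φ * seqNorm p f := by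
  have h := eLpNorm_smul_le_mul_eLpNorm (p := q) (q := p) (r := 1) (aestronglyMeasurable_seq f)
    (aestronglyMeasurable_seq φ)
  rwa [eLpNorm_one_eq_lintegral_enorm, lintegral_count] at h

theorem exists_holderConjugate {p : ℝ≥0∞} (hp : 1 ≤ p) (hp' : p ≠ ∞) :
    ∃ q : ℝ≥0∞, 1 < q ∧ ENNReal.HolderConjugate q p := by
  have h1 : p⁻¹ ≤ 1 := ENNReal.inv_le_one.2 hp
  refine ⟨(1 - p⁻¹)⁻¹, ?_, ⟨?_⟩⟩
  · rw [ENNReal.one_lt_inv]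
    exact ENNReal.sub_lt_self ENNReal.one_ne_top one_ne_zero (ENNReal.inv_ne_zero.2 hp')
  · rw [inv_inv, inv_one, tsub_add_cancel_of_le h1]

/-- Hölder: the rows of the inverse decay like `1/(j + 1)` uniformly in `n`, and this lies in `ℓ^q`
for the conjugate exponent because `p < ∞` gives `q > 1`. -/
theorem exists_tsum_weylKernel_le {α : ℝ} (hα : 0 ≤ α) {p : ℝ≥0∞} (hp : 1 ≤ p) (hp' : p ≠ ∞) :
    ∃ C : ℝ≥0∞, C ≠ ∞ ∧ ∀ (f : ℕ → ℂ) (n : ℕ),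
      ∑' m, ‖weylKernel (α : ℂ) n m * (f m / cesaroNumber ((α : ℂ) + 1) m)‖ₑ ≤ C * seqNorm p f := by
  obtain ⟨q, hq, hqp⟩ := exists_holderConjugate hp hp'
  refine ⟨_, (seqNorm_inv_lt_top hq (1 + α)).ne, fun f n => ?_⟩
  have h1 := (add_right_injective n).tsum_eq
    (f := fun m => ‖weylKernel (α : ℂ) n m * (f m / cesaroNumber ((α : ℂ) + 1) m)‖ₑ)
    fun m hm => ⟨m - n, Nat.add_sub_cancel' (not_lt.1 fun h => hm (by
      simp [weylKernel, not_le.2 h]))⟩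
  rw [← h1]
  calc _ = ∑' j, ‖cesaroNumber (α : ℂ) j / cesaroNumber ((α : ℂ) + 1) (n + j) * f (n + j)‖ₑ := by
        refine tsum_congr fun j => ?_
        simp only [weylKernel, le_add_iff_nonneg_right, zero_le, if_true, Nat.add_sub_cancel_left]
        congr 1
        ring
    _ ≤ seqNorm q (fun j => cesaroNumber (α : ℂ) j / cesaroNumber ((α : ℂ) + 1) (n + j)) *
          seqNorm p (fun j => f (n + j)) :=
        tsum_enorm_mul_le (p := p) (q := q)
          (fun j => cesaroNumber (α : ℂ) j / cesaroNumber ((α : ℂ) + 1) (n + j)) fun j => f (n + j)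
    _ ≤ _ := by
        refine mul_le_mul' (eLpNorm_mono fun j => ?_) (seqNorm_shift_le hp hp' f n)
        refine (norm_cesaroNumber_div_le hα n j).trans (le_of_eq ?_)
        rw [Complex.norm_of_nonneg (by positivity)]

/-- The inverse of `D^α`. -/
noncomputable def inverseWeyl (α : ℝ) (f : ℕ → ℂ) (n : ℕ) : ℂ :=
  ∑' m, weylKernel (α : ℂ) n m * (f m / cesaroNumber ((α : ℂ) + 1) m)

theorem summable_of_tsum_enorm_lt_top {f : ℕ → ℂ} (h : ∑' m, ‖f m‖ₑ < ∞) :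
    Summable fun m => ‖f m‖ := by
  simpa using ENNReal.summable_toReal h.ne

/-- The `n`-th entry sees only the tail of `f` from `n` on, whose `ℓ^p` norm tends to `0`. -/
theorem inverseWeyl_tendsto_zero {α : ℝ} (hα : 0 ≤ α) {p : ℝ≥0∞} (hp : 1 ≤ p) (hp' : p ≠ ∞)
    {f : ℕ → ℂ} (hf : seqNorm p f < ∞) : Tendsto (inverseWeyl α f) atTop (𝓝 0) := by
  obtain ⟨C, hC, hb⟩ := exists_tsum_weylKernel_le hα hp hp'
  have h1 : ∀ n, ‖inverseWeyl α f n‖ₑ ≤ C * seqNorm p (f - truncate n f) := by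
    intro n
    have h2 : inverseWeyl α f n = ∑' m, weylKernel (α : ℂ) n m *
        ((f - truncate n f) m / cesaroNumber ((α : ℂ) + 1) m) := by
      refine tsum_congr fun m => ?_
      rcases lt_or_ge m n with hm | hm
      · simp [weylKernel, not_le.2 hm]
      · simp [truncate, not_lt.2 hm]
    rw [h2]
    exact enorm_tsum_le_tsum_enorm.trans (hb _ n)
  have h2 : Tendsto (fun n => ‖inverseWeyl α f n‖ₑ) atTop (𝓝 0) := by
    refine tendsto_of_tendsto_of_tendsto_of_le_of_le tendsto_const_nhds ?_ (fun _ => zero_le) h1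
    simpa using ENNReal.Tendsto.const_mul (tendsto_seqNorm_sub_truncate hp hp' hf) (Or.inr hC)
  rw [tendsto_zero_iff_norm_tendsto_zero]
  simpa [Function.comp_def] using (ENNReal.tendsto_toReal ENNReal.zero_ne_top).comp h2

theorem weylKernel_zero (n m : ℕ) : weylKernel 0 n m = if m = n then 1 else 0 := by
  simp only [weylKernel, cesaroNumber_zero_left]
  split_ifs <;> first | rfl | omega

theorem tsum_weylKernel_zero_mul (f : ℕ → ℂ) (n : ℕ) : ∑' m, weylKernel 0 n m * f m = f n := by
  rw [tsum_eq_single n]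
  · simp [weylKernel_zero]
  · intro m hm
    simp [weylKernel_zero, hm]

theorem weylDifference_zero (f : ℕ → ℂ) : weylDifference 0 f = f := by
  ext n
  rw [weylDifference_eq_tsum]
  simpa using tsum_weylKernel_zero_mul f n

theorem weightedWeyl_inverseWeyl {α : ℝ} (hα : 0 ≤ α) {p : ℝ≥0∞} (hp : 1 ≤ p) (hp' : p ≠ ∞)
    {f : ℕ → ℂ} (hf : seqNorm p f < ∞) : weightedWeyl α (inverseWeyl α f) = f := by
  obtain ⟨C, hC, hb⟩ := exists_tsum_weylKernel_le hα hp hp'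
  have hCf : C * seqNorm p f < ∞ := ENNReal.mul_lt_top hC.lt_top hf
  have hs : ∀ n, Summable fun m =>
      ‖weylKernel (α : ℂ) n m * (f m / cesaroNumber ((α : ℂ) + 1) m)‖ := fun n =>
    summable_of_tsum_enorm_lt_top ((hb f n).trans_lt hCf)
  ext n
  rw [weightedWeyl, weylDifference_eq_tsum]
  simp only [inverseWeyl]
  rw [tsum_kernel_comp (b := fun _ => (C * seqNorm p f).toReal) (K := weylKernel (-(α : ℂ)) n) hs]
  · simp only [tsum_weylKernel_mul_weylKernel, neg_add_cancel]
    rw [tsum_weylKernel_zero_mul, mul_div_cancel₀ _ (cesaroNumber_add_one_ne_zero hα n)]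
  · intro l
    have h1 := ENNReal.toReal_mono hCf.ne (hb f l)
    rw [ENNReal.tsum_toReal_eq fun m => enorm_ne_top] at h1
    simpa using h1
  · exact (summable_norm_weylKernel_neg hα n).mul_right _

theorem weylDifference_weylDifference {α β : ℝ} (hα : 0 ≤ α) (hβ : 0 ≤ β) {f : ℕ → ℂ}
    (hf : BoundedSeq f) :
    weylDifference α (weylDifference β f) = weylDifference (α + β) f := by
  obtain ⟨C, hC⟩ := hf
  ext n
  rw [weylDifference_eq_tsum, weylDifference_eq_tsum]
  simp only [weylDifference_eq_tsum]
  rw [tsum_kernel_comp (b := fun _ => (∑' j, ‖cesaroNumber (-(β : ℂ)) j‖) * C)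
    (K := weylKernel (-(α : ℂ)) n) (summable_weylKernel_mul hβ ⟨C, hC⟩)
    (tsum_norm_weylKernel_mul_le hβ hC) ((summable_norm_weylKernel_neg hα n).mul_right _)]
  simp only [tsum_weylKernel_mul_weylKernel]
  push_cast
  simp only [neg_add]

theorem weylDifference_one (f : ℕ → ℂ) (n : ℕ) : weylDifference 1 f n = f n - f (n + 1) := by
  rw [weylDifference, tsum_eq_sum (s := Finset.range 2)]
  · simp [Finset.sum_range_succ, cesaroNumber]
    ring
  · intro j hj
    have := cesaroNumber_neg_natCast_eq_zero 1 (n := j) (by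
      simpa [Nat.succ_le_iff] using hj)
    simp only [Nat.cast_one] at this
    simp [this]

/-- Induction on the order: a null sequence whose first difference vanishes is constant, hence zero.
-/
theorem eq_zero_of_weylDifference_natCast {m : ℕ} {f : ℕ → ℂ} (hf : Tendsto f atTop (𝓝 0))
    (h : weylDifference m f = 0) : f = 0 := by
  induction m generalizing f with
  | zero => simpa [weylDifference_zero] using h
  | succ m ih =>
    have hb := BoundedSeq.of_tendsto hf
    rw [Nat.cast_succ, ← weylDifference_weylDifference (by positivity) zero_le_one hb] at h
    have h1 : Tendsto (weylDifference 1 f) atTop (𝓝 0) := by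
      have : weylDifference 1 f = fun n => f n - f (n + 1) := funext (weylDifference_one f)
      rw [this]
      simpa using hf.sub ((tendsto_add_atTop_iff_nat 1).2 hf)
    have h2 := ih h1 h
    have h3 : ∀ n, f (n + 1) = f n := fun n => by
      have := congrFun h2 n
      rw [weylDifference_one, Pi.zero_apply, sub_eq_zero] at this
      exact this.symm
    have h4 : ∀ n, f n = f 0 := fun n => by
      induction n with
      | zero => rfl
      | succ n ih => rw [h3, ih]
    have h5 : f 0 = 0 := by
      refine tendsto_nhds_unique ?_ hf
      rw [show f = fun _ => f 0 from funext h4]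
      exact tendsto_const_nhds
    ext n
    rw [h4, h5, Pi.zero_apply]

/-- `D^α` is injective on the sequences that vanish at infinity. -/
theorem eq_zero_of_weightedWeyl_eq_zero {α : ℝ} (hα : 0 ≤ α) {f : ℕ → ℂ}
    (hf : Tendsto f atTop (𝓝 0)) (h : weightedWeyl α f = 0) : f = 0 := by
  have h1 : weylDifference α f = 0 := by
    ext n
    exact (mul_eq_zero.1 (congrFun h n)).resolve_left (cesaroNumber_add_one_ne_zero hα n)
  -- Applying `W^{⌈α⌉ - α}` raises the order to an integer.
  refine eq_zero_of_weylDifference_natCast (m := ⌈α⌉₊) hf ?_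
  have h2 := weylDifference_weylDifference (sub_nonneg.2 (Nat.le_ceil α)) hα
    (BoundedSeq.of_tendsto hf)
  rw [h1, sub_add_cancel] at h2
  rw [← h2]
  ext n
  simp [weylDifference]

theorem inverseWeyl_weightedWeyl {α : ℝ} (hα : 0 ≤ α) {p : ℝ≥0∞} (hp : 1 ≤ p) (hp' : p ≠ ∞)
    {f : ℕ → ℂ} (hf : Tendsto f atTop (𝓝 0)) (hf' : seqNorm p (weightedWeyl α f) < ∞) :
    inverseWeyl α (weightedWeyl α f) = f := by
  have h1 := inverseWeyl_tendsto_zero hα hp hp' hf'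
  have h2 := h1.sub hf
  rw [sub_zero] at h2
  refine sub_eq_zero.1 (eq_zero_of_weightedWeyl_eq_zero hα h2 ?_)
  rw [weightedWeyl_sub hα (.of_tendsto h1) (.of_tendsto hf),
    weightedWeyl_inverseWeyl hα hp hp' hf', sub_self]

/-- For `p < ∞` the space `τ_p^α` is continuously embedded in the bounded sequences. -/
theorem exists_enorm_le_seqNorm_weightedWeyl {α : ℝ} (hα : 0 ≤ α) {p : ℝ≥0∞} (hp : 1 ≤ p)
    (hp' : p ≠ ∞) : ∃ C : ℝ≥0∞, C ≠ ∞ ∧ ∀ f : ℕ → ℂ, Tendsto f atTop (𝓝 0) →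
      seqNorm p (weightedWeyl α f) < ∞ → ∀ n, ‖f n‖ₑ ≤ C * seqNorm p (weightedWeyl α f) := by
  obtain ⟨C, hC, hb⟩ := exists_tsum_weylKernel_le hα hp hp'
  refine ⟨C, hC, fun f hf hf' n => ?_⟩
  calc ‖f n‖ₑ = ‖inverseWeyl α (weightedWeyl α f) n‖ₑ := by
        rw [inverseWeyl_weightedWeyl hα hp hp' hf hf']
    _ ≤ _ := enorm_tsum_le_tsum_enorm.trans (hb _ n)

/-! ### The spaces `τ_p^α` and generator graphs -/

theorem tauNorm_of_ne_top (α : ℝ) {p : ℝ≥0∞} (hp' : p ≠ ∞) (f : ℕ → ℂ) :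
    tauNorm α p f = seqNorm p (weightedWeyl α f) := if_neg hp'

theorem tauNorm_top (α : ℝ) (f : ℕ → ℂ) :
    tauNorm α ∞ f = max (seqNorm ∞ f) (seqNorm ∞ (weightedWeyl α f)) := if_pos rfl

theorem tauNorm_smul (α : ℝ) (p : ℝ≥0∞) (z : ℂ) (f : ℕ → ℂ) :
    tauNorm α p (z • f) = ‖z‖ₑ * tauNorm α p f := by
  by_cases hp' : p = ∞
  · subst hp'
    rw [tauNorm_top, tauNorm_top, weightedWeyl_smul, seqNorm_smul, seqNorm_smul, mul_max]
  · rw [tauNorm_of_ne_top α hp', tauNorm_of_ne_top α hp', weightedWeyl_smul, seqNorm_smul]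

theorem mem_tau_iff {α : ℝ} {p : ℝ≥0∞} (hp' : p ≠ ∞) {f : ℕ → ℂ} :
    f ∈ tau α p ↔ Tendsto f atTop (𝓝 0) ∧ seqNorm p (weightedWeyl α f) < ∞ := by
  simp [tau, tauNorm_of_ne_top α hp', hp']

theorem mem_tau_top_iff {α : ℝ} {f : ℕ → ℂ} :
    f ∈ tau α ∞ ↔ seqNorm ∞ f < ∞ ∧ seqNorm ∞ (weightedWeyl α f) < ∞ := by
  simp [tau, tauNorm_top]

theorem boundedSeq_of_mem_tau {α : ℝ} {p : ℝ≥0∞} {f : ℕ → ℂ} (hf : f ∈ tau α p) :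
    BoundedSeq f := by
  by_cases hp' : p = ∞
  · subst hp'
    exact .of_seqNorm_lt_top le_top (mem_tau_top_iff.1 hf).1
  · exact .of_tendsto (hf.1 hp')

theorem smul_mem_tau {α : ℝ} {p : ℝ≥0∞} {f : ℕ → ℂ} (hf : f ∈ tau α p) (z : ℂ) :
    z • f ∈ tau α p := by
  refine ⟨fun hp' => ?_, ?_⟩
  · have := (hf.1 hp').const_smul z
    rw [smul_zero] at this
    exact this
  · rw [tauNorm_smul]
    exact ENNReal.mul_lt_top enorm_lt_top hf.2

theorem sub_mem_tau {α : ℝ} (hα : 0 ≤ α) {p : ℝ≥0∞} (hp : 1 ≤ p) {f g : ℕ → ℂ}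
    (hf : f ∈ tau α p) (hg : g ∈ tau α p) : f - g ∈ tau α p := by
  have h1 := weightedWeyl_sub hα (boundedSeq_of_mem_tau hf) (boundedSeq_of_mem_tau hg)
  by_cases hp' : p = ∞
  · subst hp'
    rw [mem_tau_top_iff] at *
    rw [h1]
    exact ⟨(seqNorm_sub_le hp _ _).trans_lt (ENNReal.add_lt_top.2 ⟨hf.1, hg.1⟩),
      (seqNorm_sub_le hp _ _).trans_lt (ENNReal.add_lt_top.2 ⟨hf.2, hg.2⟩)⟩
  · rw [mem_tau_iff hp'] at *
    rw [h1]
    refine ⟨?_, (seqNorm_sub_le hp _ _).trans_lt (ENNReal.add_lt_top.2 ⟨hf.2, hg.2⟩)⟩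
    have := hf.1.sub hg.1
    rw [sub_zero] at this
    exact this

theorem diffQuotient_mem_tau {α : ℝ} (hα : 0 ≤ α) {p : ℝ≥0∞} (hp : 1 ≤ p)
    {U : ℝ → (ℕ → ℂ) → (ℕ → ℂ)} {f : ℕ → ℂ} {t : ℝ} (hf : f ∈ tau α p) (hU : U t f ∈ tau α p) :
    diffQuotient U f t ∈ tau α p :=
  smul_mem_tau (sub_mem_tau hα hp hU hf) _

theorem tauNorm_eq_zero {α : ℝ} (hα : 0 ≤ α) {p : ℝ≥0∞} (hp : 1 ≤ p) {f : ℕ → ℂ}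
    (hf : f ∈ tau α p) (h : tauNorm α p f = 0) : f = 0 := by
  by_cases hp' : p = ∞
  · subst hp'
    rw [tauNorm_top] at h
    exact seqNorm_eq_zero hp (le_antisymm ((le_max_left _ _).trans h.le) zero_le)
  · rw [tauNorm_of_ne_top α hp'] at h
    exact eq_zero_of_weightedWeyl_eq_zero hα (hf.1 hp') (seqNorm_eq_zero hp h)

/-- Convergence in `τ_p^α` implies coordinatewise convergence. -/
theorem tendsto_of_mem_generatorGraph {α : ℝ} (hα : 0 ≤ α) {p : ℝ≥0∞} (hp : 1 ≤ p)
    {U : ℝ → (ℕ → ℂ) → (ℕ → ℂ)} {f g : ℕ → ℂ} (h : (f, g) ∈ generatorGraph α p U) (n : ℕ) :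
    Tendsto (fun t : ℝ => diffQuotient U f t n) (𝓝[>] 0) (𝓝 (g n)) := by
  obtain ⟨hf, hg, hU, h1, h2⟩ := h
  by_cases hp' : p = ∞
  · exact (h2 hp').2 n
  obtain ⟨C, hC, hb⟩ := exists_enorm_le_seqNorm_weightedWeyl hα hp hp'
  have h3 : Tendsto (fun t : ℝ => ‖diffQuotient U f t n - g n‖ₑ) (𝓝[>] 0) (𝓝 0) := by
    have h4 := ENNReal.Tendsto.const_mul (h1 hp') (Or.inr hC)
    rw [mul_zero] at h4
    refine tendsto_of_tendsto_of_tendsto_of_le_of_le' tendsto_const_nhds h4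
      (.of_forall fun _ => zero_le) ?_
    filter_upwards [self_mem_nhdsWithin] with t ht
    have h5 := (mem_tau_iff hp').1
      (sub_mem_tau hα hp (diffQuotient_mem_tau hα hp hf (hU t ht)) hg)
    rw [tauNorm_of_ne_top α hp']
    exact hb _ h5.1 h5.2 n
  rw [tendsto_iff_norm_sub_tendsto_zero]
  simpa [Function.comp_def] using (ENNReal.tendsto_toReal ENNReal.zero_ne_top).comp h3

/-- The difference quotient is the scalar `(e^{zt} - 1)/t` times `f`, so both kinds of convergence
reduce to a scalar limit. -/
theorem mem_generatorGraph_of_eigenvector {α : ℝ} {p : ℝ≥0∞}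
    {U : ℝ → (ℕ → ℂ) → (ℕ → ℂ)} {f : ℕ → ℂ} {z : ℂ} (hf : f ∈ tau α p)
    (hU : ∀ t : ℝ, 0 < t → U t f = Complex.exp (z * t) • f) :
    (f, z • f) ∈ generatorGraph α p U := by
  have h1 : ∀ t : ℝ, 0 < t →
      diffQuotient U f t = ((t : ℂ)⁻¹ * (Complex.exp (z * t) - 1)) • f := by
    intro t ht
    rw [diffQuotient, hU t ht, mul_smul, sub_smul, one_smul]
  have hlim := tendsto_exp_sub_one_div z
  refine ⟨hf, smul_mem_tau hf z, fun t ht => by simpa [hU t ht] using smul_mem_tau hf _,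
    fun _ => ?_, fun _ => ⟨?_, fun n => ?_⟩⟩
  · have h2 : Tendsto (fun t : ℝ => ‖(t : ℂ)⁻¹ * (Complex.exp (z * t) - 1) - z‖ₑ * tauNorm α p f)
        (𝓝[>] 0) (𝓝 0) := by
      have h3 : Tendsto (fun t : ℝ => ‖(t : ℂ)⁻¹ * (Complex.exp (z * t) - 1) - z‖ₑ)
          (𝓝[>] 0) (𝓝 0) := by
        have := (continuous_enorm.tendsto _).comp (hlim.sub_const z)
        simpa [Function.comp_def] using this
      simpa using ENNReal.Tendsto.mul_const h3 (Or.inr hf.2.ne)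
    refine h2.congr' ?_
    filter_upwards [self_mem_nhdsWithin] with t ht
    rw [h1 t ht, ← sub_smul, tauNorm_smul]
  · refine ⟨((‖z‖ₑ + 1) * tauNorm α p f).toNNReal, ?_⟩
    rw [ENNReal.coe_toNNReal (ENNReal.mul_ne_top (by finiteness) hf.2.ne)]
    have h3 : ∀ᶠ t : ℝ in 𝓝[>] 0, ‖(t : ℂ)⁻¹ * (Complex.exp (z * t) - 1)‖ₑ ≤ ‖z‖ₑ + 1 :=
      ((continuous_enorm.tendsto _).comp hlim).eventually_le_const
        (ENNReal.lt_add_right enorm_ne_top one_ne_zero)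
    filter_upwards [self_mem_nhdsWithin, h3] with t ht h4
    rw [h1 t ht, tauNorm_smul]
    exact mul_le_mul_left h4 _
  · refine (hlim.mul_const (f n)).congr' ?_
    filter_upwards [self_mem_nhdsWithin] with t ht
    rw [h1 t ht, Pi.smul_apply, smul_eq_mul]

theorem genB_eq_of_mem_generatorB {α : ℝ} (hα : 0 ≤ α) {p : ℝ≥0∞} (hp : 1 ≤ p) {f g : ℕ → ℂ}
    (h : (f, g) ∈ generatorB α p) : genB p f = g := by
  ext n
  exact tendsto_nhds_unique
    (tendsto_diffQuotient_semigroupS p (boundedSeq_of_mem_tau h.1).tame n)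
    (tendsto_of_mem_generatorGraph hα hp h n)

theorem cesaroNumber_ne_zero (a : ℂ) : cesaroNumber a ≠ 0 := fun h => by
  have := congrFun h 0
  simp [cesaroNumber_zero_right] at this

/-! ### The generator of `T_p(t)` -/

theorem hasDerivAt_semigroupT (p : ℝ≥0∞) (f : ℕ → ℂ) (n : ℕ) :
    HasDerivAt (fun t : ℝ => semigroupT p t f n)
      (-((1 / p).toReal + n) * f n + n * f (n - 1)) 0 := by
  set c := (1 / p).toReal
  -- At `t = 0` the powers of `0` leave only `j = n` and `j = n - 1`. For `n = 0` the value `f (n -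
  -- 1)` is harmless, having coefficient `0`.
  have hterm : ∀ j ∈ Finset.range (n + 1), HasDerivAt (fun t : ℝ =>
      (((n.choose j : ℝ) * Real.exp (-(t * j)) * (1 - Real.exp (-t)) ^ (n - j) : ℝ) : ℂ) * f j)
      (((n.choose j : ℝ) * (-(j : ℝ) * 0 ^ (n - j) +
        ((n - j : ℕ) : ℝ) * 0 ^ (n - j - 1)) : ℝ) * f j) 0 := by
    intro j _
    have h1 : HasDerivAt (fun t : ℝ => Real.exp (-(t * j))) (-(j : ℝ)) 0 := by
      simpa using ((hasDerivAt_id (0 : ℝ)).mul_const (j : ℝ)).neg.exp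
    have h2 : HasDerivAt (fun t : ℝ => 1 - Real.exp (-t)) 1 0 := by
      simpa using (hasDerivAt_neg (0 : ℝ)).exp.const_sub 1
    have h3 := ((h1.mul (h2.pow (n - j))).const_mul (n.choose j : ℝ)).ofReal_comp.mul_const (f j)
    refine (h3.congr_deriv ?_).congr_of_eventuallyEq (.of_forall fun t => ?_)
    · simp
    · simp [mul_assoc]
  have h0 : HasDerivAt (fun t : ℝ => (Real.exp (-(t * c)) : ℂ)) (-(c : ℂ)) 0 := by
    have : HasDerivAt (fun t : ℝ => Real.exp (-(t * c))) (-c) 0 := by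
      simpa using ((hasDerivAt_id (0 : ℝ)).mul_const c).neg.exp
    simpa using this.ofReal_comp
  have h := h0.mul (HasDerivAt.fun_sum hterm)
  refine h.congr_deriv ?_
  have hval : ∑ j ∈ Finset.range (n + 1),
      (((n.choose j : ℝ) * Real.exp (-(0 * j)) * (1 - Real.exp (-0)) ^ (n - j) : ℝ) : ℂ) * f j =
        f n := by
    rw [Finset.sum_range_succ, Finset.sum_eq_zero]
    · simp
    · intro j hj
      have : n - j ≠ 0 := Nat.sub_ne_zero_of_lt (Finset.mem_range.1 hj)
      simp [this]
  have hder : ∑ j ∈ Finset.range (n + 1), (((n.choose j : ℝ) * (-(j : ℝ) * 0 ^ (n - j) +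
        ((n - j : ℕ) : ℝ) * 0 ^ (n - j - 1)) : ℝ) : ℂ) * f j = -n * f n + n * f (n - 1) := by
    cases n with
    | zero => simp
    | succ n =>
      rw [Finset.sum_range_succ, Finset.sum_range_succ, Finset.sum_eq_zero]
      · simp
        ring
      · intro j hj
        have hj := Finset.mem_range.1 hj
        have h1 : n + 1 - j ≠ 0 := by omega
        have h2 : n + 1 - j - 1 ≠ 0 := by omega
        simp [h1, h2]
  rw [hval, hder]
  simp
  ring

theorem recursion_of_mem_generatorA {α : ℝ} (hα : 0 ≤ α) {p : ℝ≥0∞} (hp : 1 ≤ p)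
    {f g : ℕ → ℂ} (h : (f, g) ∈ generatorA α p) (n : ℕ) :
    g n = -((1 / p).toReal + n) * f n + n * f (n - 1) := by
  have h1 := (hasDerivWithinAt_iff_tendsto_slope' (s := Set.Ioi 0) (by simp)).1
    (hasDerivAt_semigroupT p f n).hasDerivWithinAt
  have h0 : semigroupT p 0 f n = f n := by
    rw [semigroupT, Finset.sum_range_succ, Finset.sum_eq_zero]
    · simp
    · intro j hj
      have : n - j ≠ 0 := Nat.sub_ne_zero_of_lt (Finset.mem_range.1 hj)
      simp [this]
  refine tendsto_nhds_unique (tendsto_of_mem_generatorGraph hα hp h n) (h1.congr fun t => ?_)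
  simp [slope_def_module, diffQuotient, h0]

theorem eigenvector_generatorA {c : ℝ} {z : ℂ} {f : ℕ → ℂ} (hf : BoundedSeq f)
    (hf0 : f ≠ 0) (h : ∀ n : ℕ, z * f n = -(c + n) * f n + n * f (n - 1)) :
    z = -c ∧ ∀ n, f n = f 0 := by
  have hrec : ∀ n : ℕ, (z + c + n) * f n = n * f (n - 1) := fun n => by
    linear_combination h n
  obtain ⟨m, hm, hmin⟩ : ∃ m, f m ≠ 0 ∧ ∀ k < m, f k = 0 := by
    classical
    have hex : ∃ m, f m ≠ 0 := by
      by_contra! hcon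
      exact hf0 (funext hcon)
    exact ⟨Nat.find hex, Nat.find_spec hex, fun k hk => not_not.1 (Nat.find_min hex hk)⟩
  -- At the first nonzero index `m` the recursion has no inflow, which fixes the eigenvalue.
  have hz : z + c + m = 0 := by
    have h1 := hrec m
    have h2 : (m : ℂ) * f (m - 1) = 0 := by
      rcases Nat.eq_zero_or_pos m with rfl | h3
      · simp
      · rw [hmin (m - 1) (by omega), mul_zero]
    rw [h2] at h1
    exact (mul_eq_zero.1 h1).resolve_right hm
  have hrec' : ∀ k : ℕ, ((k : ℂ) + 1) * f (m + k + 1) = (m + k + 1) * f (m + k) := fun k => by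
    have := hrec (m + k + 1)
    rw [Nat.add_sub_cancel] at this
    push_cast at this
    linear_combination this - f (m + k + 1) * hz
  rcases Nat.eq_zero_or_pos m with rfl | hmpos
  · refine ⟨by simpa [add_eq_zero_iff_eq_neg] using hz, fun n => ?_⟩
    induction n with
    | zero => rfl
    | succ n ih =>
      have h1 := hrec' n
      have h2 : (n : ℂ) + 1 ≠ 0 := by exact_mod_cast n.succ_ne_zero
      simp only [zero_add, Nat.cast_zero] at h1
      rw [← ih]
      exact mul_left_cancel₀ h2 h1
  · exfalso
    -- The recursion gives `f (m + k) = C(m + k, k) f m`, at least linear growth when `m ≥ 1`.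
    have hgrow : ∀ k : ℕ, ((k : ℝ) + 1) * ‖f m‖ ≤ ‖f (m + k)‖ := by
      intro k
      induction k with
      | zero => simp
      | succ k ih =>
        have h1 := congrArg norm (hrec' k)
        have h2 : ‖(k : ℂ) + 1‖ = k + 1 := by exact_mod_cast Complex.norm_natCast (k + 1)
        have h3 : ‖(m : ℂ) + k + 1‖ = m + k + 1 := by
          exact_mod_cast Complex.norm_natCast (m + k + 1)
        rw [norm_mul, norm_mul, h2, h3] at h1
        have h4 : (1 : ℝ) ≤ m := by exact_mod_cast hmpos
        have h5 : (0 : ℝ) ≤ k := by positivity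
        refine le_of_mul_le_mul_left ?_ (show (0 : ℝ) < k + 1 by positivity)
        rw [← add_assoc m k 1, h1]
        push_cast
        calc ((k : ℝ) + 1) * ((k + 1 + 1) * ‖f m‖) = (k + 1 + 1) * ((k + 1) * ‖f m‖) := by ring
          _ ≤ (m + k + 1) * ‖f (m + k)‖ := by
            refine mul_le_mul (by linarith) ih (by positivity) (by positivity)
    obtain ⟨C, hC⟩ := hf
    obtain ⟨k, hk⟩ := exists_nat_gt (C / ‖f m‖)
    have hpos : 0 < ‖f m‖ := norm_pos_iff.2 hm
    rw [div_lt_iff₀ hpos] at hk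
    have := (hgrow k).trans (hC (m + k))
    nlinarith

theorem pointSpectrum_generatorA_of_ne_top {α : ℝ} (hα : 0 ≤ α) {p : ℝ≥0∞} (hp : 1 ≤ p)
    (hp' : p ≠ ∞) : pointSpectrum (generatorA α p) = ∅ := by
  refine Set.eq_empty_of_forall_notMem fun z ⟨f, hf0, hf⟩ => hf0 ?_
  obtain ⟨-, h1 : ∀ n, f n = f 0⟩ := eigenvector_generatorA (boundedSeq_of_mem_tau hf.1) hf0
    (recursion_of_mem_generatorA hα hp hf)
  have h2 : f 0 = 0 := by
    refine tendsto_nhds_unique ?_ (hf.1.1 hp')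
    rw [show f = fun _ => f 0 from funext h1]
    exact tendsto_const_nhds
  ext n
  rw [h1, h2, Pi.zero_apply]

theorem semigroupT_one (t : ℝ) : semigroupT ∞ t 1 = 1 := by
  ext n
  have h := add_pow (Real.exp (-t)) (1 - Real.exp (-t)) n
  rw [add_sub_cancel, one_pow] at h
  have h1 : ∑ j ∈ Finset.range (n + 1), (n.choose j : ℝ) * Real.exp (-(t * j)) *
      (1 - Real.exp (-t)) ^ (n - j) = 1 := by
    refine Eq.trans ?_ h.symm
    refine Finset.sum_congr rfl fun j _ => ?_
    rw [← Real.exp_nat_mul, show (j : ℝ) * -t = -(t * j) by ring]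
    ring
  simp only [semigroupT, Pi.one_apply, mul_one, ← Complex.ofReal_sum, h1]
  simp

/-! ### Point spectra on `τ_p^α` -/

theorem weightedWeyl_diffQuotient_semigroupS {α : ℝ} (hα : 0 ≤ α) (p : ℝ≥0∞) {f : ℕ → ℂ}
    (hf : BoundedSeq f) {t : ℝ} (ht : 0 ≤ t) :
    weightedWeyl α (diffQuotient (semigroupS p) f t) =
      diffQuotient (semigroupS p) (weightedWeyl α f) t := by
  rw [diffQuotient, weightedWeyl_smul, weightedWeyl_sub hα (hf.semigroupS p ht) hf,
    weightedWeyl_semigroupS hα p ht hf, diffQuotient]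

theorem tendsto_zero_of_seqNorm_lt_top {p : ℝ≥0∞} (hp : 1 ≤ p) (hp' : p ≠ ∞) {f : ℕ → ℂ}
    (hf : seqNorm p f < ∞) : Tendsto f atTop (𝓝 0) := by
  have hP := zero_lt_one.trans_le (one_le_toReal hp hp')
  have h1 := ((seqNorm_lt_top_iff_summable hp hp').1 hf).tendsto_atTop_zero.rpow_const
    (p := 1 / p.toReal) (Or.inr (by positivity))
  rw [Real.zero_rpow (by positivity)] at h1
  rw [tendsto_zero_iff_norm_tendsto_zero]
  refine h1.congr fun n => ?_
  rw [← Real.rpow_mul (norm_nonneg _), mul_one_div, div_self hP.ne', Real.rpow_one]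

/-- `D^α` maps bounded eigenvectors to eigenvectors. -/
theorem genB_weightedWeyl_of_genB_eq {α : ℝ} (hα : 0 ≤ α) {p : ℝ≥0∞} {z : ℂ} {f : ℕ → ℂ}
    (hf : BoundedSeq f) (h : genB p f = z • f) :
    genB p (weightedWeyl α f) = z • weightedWeyl α f := by
  have h1 := eq_cesaroNumber_of_genB_eq (p := p) (z := z) (f := f) fun n => congrFun h n
  have h2 : ∀ t : ℝ, 0 ≤ t → semigroupS p t f = Complex.exp (z * t) • f := by
    intro t ht
    rw [h1, semigroupS_smul, semigroupS_cesaroNumber p ht, smul_comm]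
  ext n
  refine tendsto_nhds_unique
    (tendsto_diffQuotient_semigroupS p (hf.tame_weightedWeyl hα) n)
    (((tendsto_exp_sub_one_div z).mul_const (weightedWeyl α f n)).congr' ?_)
  filter_upwards [self_mem_nhdsWithin] with t (ht : 0 < t)
  rw [diffQuotient, ← weightedWeyl_semigroupS hα p ht.le hf, h2 t ht.le, weightedWeyl_smul]
  simp only [Pi.smul_apply, Pi.sub_apply, smul_eq_mul]
  ring

theorem genB_cesaroNumber (p : ℝ≥0∞) (z : ℂ) :
    genB p (cesaroNumber (z + 1 - ((1 / p).toReal : ℂ))) =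
      z • cesaroNumber (z + 1 - ((1 / p).toReal : ℂ)) := by
  ext n
  simp only [genB, Pi.smul_apply, smul_eq_mul]
  linear_combination cesaroNumber_succ (z + 1 - ((1 / p).toReal : ℂ)) n

/-- `D^α` of this sequence solves the same recursion, so it is a scalar multiple of the sequence and
has finite `ℓ^p` norm too. -/
theorem cesaroNumber_mem_tau {α : ℝ} (hα : 0 ≤ α) {p : ℝ≥0∞} (hp : 1 ≤ p) {z : ℂ}
    (h : seqNorm p (cesaroNumber (z + 1 - ((1 / p).toReal : ℂ))) < ∞) :
    cesaroNumber (z + 1 - ((1 / p).toReal : ℂ)) ∈ tau α p := by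
  set f := cesaroNumber (z + 1 - ((1 / p).toReal : ℂ)) with hf
  have h1 := eq_cesaroNumber_of_genB_eq fun n => congrFun (genB_weightedWeyl_of_genB_eq hα
    (.of_seqNorm_lt_top hp h) (genB_cesaroNumber p z)) n
  have h2 : seqNorm p (weightedWeyl α f) < ∞ := by
    rw [← hf] at h1
    rw [h1, seqNorm_smul]
    exact ENNReal.mul_lt_top enorm_lt_top h
  by_cases hp' : p = ∞
  · subst hp'
    exact mem_tau_top_iff.2 ⟨h, h2⟩
  · exact (mem_tau_iff hp').2 ⟨tendsto_zero_of_seqNorm_lt_top hp hp' h, h2⟩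

theorem cesaroNumber_mem_generatorB {α : ℝ} (hα : 0 ≤ α) {p : ℝ≥0∞} (hp : 1 ≤ p) {z : ℂ}
    (h : seqNorm p (cesaroNumber (z + 1 - ((1 / p).toReal : ℂ))) < ∞) :
    (cesaroNumber (z + 1 - ((1 / p).toReal : ℂ)),
      z • cesaroNumber (z + 1 - ((1 / p).toReal : ℂ))) ∈ generatorB α p :=
  mem_generatorGraph_of_eigenvector (cesaroNumber_mem_tau hα hp h) fun _ ht =>
    semigroupS_cesaroNumber p ht.le z

/-- For `p < ∞` the `ℓ^p` eigenvector is `D^α f`, nonzero by injectivity. For `p = ∞`, where `D^α f`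
may vanish, `f` itself is bounded. -/
theorem seqNorm_cesaroNumber_lt_top_of_mem_tau {α : ℝ} (hα : 0 ≤ α) {p : ℝ≥0∞} {z : ℂ}
    {f : ℕ → ℂ} (hf : f ∈ tau α p) (hf0 : f ≠ 0) (h : genB p f = z • f) :
    seqNorm p (cesaroNumber (z + 1 - ((1 / p).toReal : ℂ))) < ∞ := by
  by_cases hp' : p = ∞
  · subst hp'
    exact seqNorm_cesaroNumber_lt_top_of_genB_eq hf0 (mem_tau_top_iff.1 hf).1 h
  · obtain ⟨h1, h2⟩ := (mem_tau_iff hp').1 hf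
    exact seqNorm_cesaroNumber_lt_top_of_genB_eq
      (fun h3 => hf0 (eq_zero_of_weightedWeyl_eq_zero hα h1 h3)) h2
      (genB_weightedWeyl_of_genB_eq hα (.of_tendsto h1) h)

theorem mem_pointSpectrum_generatorB_iff {α : ℝ} (hα : 0 ≤ α) {p : ℝ≥0∞} (hp : 1 ≤ p) {z : ℂ} :
    z ∈ pointSpectrum (generatorB α p) ↔
      seqNorm p (cesaroNumber (z + 1 - ((1 / p).toReal : ℂ))) < ∞ :=
  ⟨fun ⟨_, hf0, hf⟩ => seqNorm_cesaroNumber_lt_top_of_mem_tau hα hf.1 hf0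
    (genB_eq_of_mem_generatorB hα hp hf),
    fun h => ⟨_, cesaroNumber_ne_zero _, cesaroNumber_mem_generatorB hα hp h⟩⟩

theorem pointSpectrum_generatorA_top {α : ℝ} (hα : 0 ≤ α) :
    pointSpectrum (generatorA α ∞) = {0} := by
  ext z
  refine ⟨fun ⟨f, hf0, hf⟩ => ?_, ?_⟩
  · have h := (eigenvector_generatorA (boundedSeq_of_mem_tau hf.1) hf0
      (recursion_of_mem_generatorA hα le_top hf)).1
    simpa using h
  · rintro rfl
    -- The constant sequence is `k^1`, so its membership in the space is already known from the
    -- study of `B`.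
    have h1 : (1 : ℕ → ℂ) = cesaroNumber (0 + 1 - ((1 / ∞ : ℝ≥0∞).toReal : ℂ)) := by
      ext n
      simp [cesaroNumber_one]
    refine ⟨1, one_ne_zero, mem_generatorGraph_of_eigenvector ?_ fun t _ => ?_⟩
    · rw [h1]
      exact cesaroNumber_mem_tau hα le_top (seqNorm_cesaroNumber_top_lt_top (by simp))
    · simp [semigroupT_one]

/-! ### Resolvent and spectrum of `B` on `τ_p^α` -/

/-- Conjugation by `D^α`: solve in `ℓ^p` for the data `D^α h` and pull the solution `F` back. -/
theorem exists_mem_generatorB_of_ne_top {α : ℝ} (hα : 0 ≤ α) {p : ℝ≥0∞} (hp : 1 ≤ p)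
    (hp' : p ≠ ∞) {z : ℂ} (hz : 0 < z.re) {h : ℕ → ℂ} (hh : h ∈ tau α p) :
    ∃ f, (f, z • f - h) ∈ generatorB α p ∧
      tauNorm α p f ≤ ENNReal.ofReal (z.re)⁻¹ * tauNorm α p h := by
  obtain ⟨hh1, hh2⟩ := (mem_tau_iff hp').1 hh
  obtain ⟨F, hF, hFn, -⟩ := exists_sub_genB_eq hp hz hh2
  have hFfin : seqNorm p F < ∞ := hFn.trans_lt (ENNReal.mul_lt_top ENNReal.ofReal_lt_top hh2)
  set f := inverseWeyl α F
  have hf1 : Tendsto f atTop (𝓝 0) := inverseWeyl_tendsto_zero hα hp hp' hFfin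
  have hf2 : weightedWeyl α f = F := weightedWeyl_inverseWeyl hα hp hp' hFfin
  have hfb := BoundedSeq.of_tendsto hf1
  have hf : f ∈ tau α p := (mem_tau_iff hp').2 ⟨hf1, by rwa [hf2]⟩
  have hg : z • f - h ∈ tau α p := sub_mem_tau hα hp (smul_mem_tau hf z) hh
  refine ⟨f, ⟨hf, hg, fun t ht => ?_, fun _ => ?_, fun h => absurd h hp'⟩, ?_⟩
  · refine (mem_tau_iff hp').2 ⟨?_, ?_⟩
    · rw [Metric.tendsto_atTop]
      intro ε hε
      have hδ : 0 < ε / Real.exp (t * (1 / p).toReal) := by positivity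
      obtain ⟨N, hN⟩ := Metric.tendsto_atTop.1 hf1 _ (half_pos hδ)
      refine ⟨N, fun n hn => ?_⟩
      rw [dist_zero_right]
      refine (norm_semigroupS_le p ht.le (C := ε / Real.exp (t * (1 / p).toReal) / 2)
        fun m hm => ?_).trans_lt ?_
      · simpa using (hN m (hn.trans hm)).le
      · rw [← mul_div_assoc, mul_div_cancel₀ _ (Real.exp_pos _).ne']
        exact half_lt_self hε
    · rw [weightedWeyl_semigroupS hα p ht.le hfb, hf2]
      exact (seqNorm_semigroupS_le hp ht.le F).trans_lt hFfin
  · refine (tendsto_seqNorm_diffQuotient_sub hp hp' hz hFfin hh2 hF).congr' ?_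
    filter_upwards [self_mem_nhdsWithin] with t (ht : 0 < t)
    have h1 : genB p F = z • F - weightedWeyl α h := by rw [← hF]; abel
    have hq : BoundedSeq (diffQuotient (semigroupS p) f t) :=
      ((hfb.semigroupS p ht.le).sub hfb).smul _
    rw [tauNorm_of_ne_top α hp', weightedWeyl_sub hα hq (boundedSeq_of_mem_tau hg),
      weightedWeyl_sub hα (hfb.smul z) (boundedSeq_of_mem_tau hh), weightedWeyl_smul,
      weightedWeyl_diffQuotient_semigroupS hα p hfb ht.le, hf2, h1]
  · rwa [tauNorm_of_ne_top α hp', tauNorm_of_ne_top α hp', hf2]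

theorem seqNorm_diffQuotient_le {p : ℝ≥0∞} {f : ℕ → ℂ} {t : ℝ} (ht : 0 < t) {C : ℝ≥0∞}
    (h : seqNorm p (semigroupS p t f - f) ≤ ENNReal.ofReal t * C) :
    seqNorm p (diffQuotient (semigroupS p) f t) ≤ C := by
  rw [← smul_diffQuotient (semigroupS p) f ht.ne', seqNorm_smul, enorm_ofReal_of_nonneg ht.le] at h
  exact (ENNReal.mul_le_mul_iff_right (ENNReal.ofReal_pos.2 ht).ne' ENNReal.ofReal_ne_top).1 h

/-- On bounded sequences, `D^α` commutes with the resolvent of the generator of `S_∞(t)`. -/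
theorem weightedWeyl_eq_of_sub_genB_eq {α : ℝ} (hα : 0 ≤ α) {z : ℂ} (hz : 0 < z.re)
    {f h F : ℕ → ℂ} {K : ℝ≥0∞} (hK : K < ∞) (hf : BoundedSeq f) (hh : BoundedSeq h)
    (hF : BoundedSeq F) (hfh : z • f - genB ∞ f = h) (hFh : z • F - genB ∞ F = weightedWeyl α h)
    (hq : ∀ t : ℝ, 0 < t → seqNorm ∞ (diffQuotient (semigroupS ∞) f t) ≤ K) :
    weightedWeyl α f = F := by
  have hDtame := hf.tame_weightedWeyl hα
  -- The bound `K` on the difference quotients allows dominated convergence inside `D^α`.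
  have h1 : genB ∞ (weightedWeyl α f) = weightedWeyl α (genB ∞ f) := by
    ext n
    have h2 := tendsto_weightedWeyl hα (l := 𝓝[>] (0 : ℝ)) (C := K.toReal)
      (u := fun t => diffQuotient (semigroupS ∞) f t) (f := genB ∞ f) (by
        filter_upwards [self_mem_nhdsWithin] with t ht n
        have := ENNReal.toReal_mono hK.ne
          ((enorm_le_eLpNorm_count _ n ENNReal.top_ne_zero).trans (hq t ht))
        simpa using this) (tendsto_diffQuotient_semigroupS ∞ hf.tame) n
    refine tendsto_nhds_unique (tendsto_diffQuotient_semigroupS ∞ hDtame n) (h2.congr' ?_)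
    filter_upwards [self_mem_nhdsWithin] with t (ht : 0 < t)
    rw [weightedWeyl_diffQuotient_semigroupS hα ∞ hf ht.le]
  set d := weightedWeyl α f - F with hd
  have h2 : genB ∞ d = z • d := by
    have h3 : genB ∞ f = z • f - h := by rw [← hfh]; abel
    have h4 : genB ∞ F = z • F - weightedWeyl α h := by rw [← hFh]; abel
    rw [hd, genB_sub, h1, h3, h4, weightedWeyl_sub hα (hf.smul z) hh, weightedWeyl_smul, smul_sub]
    abel
  have h3 := eq_cesaroNumber_of_genB_eq (p := ∞) (z := z) (f := d) fun n => congrFun h2 n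
  have h4 : ∀ t : ℝ, 0 ≤ t → semigroupS ∞ t d = Complex.exp (z * t) • d := by
    intro t ht
    rw [h3, semigroupS_smul, semigroupS_cesaroNumber ∞ ht, smul_comm]
  obtain ⟨C, hC⟩ := hf
  obtain ⟨C', hC'⟩ := hF
  have hsup : ∀ (u : ℕ → ℂ) (c : ℝ), (∀ n, ‖u n‖ ≤ c) → ∀ t : ℝ, 0 ≤ t → ∀ n,
      ‖semigroupS ∞ t u n‖ ≤ c := by
    intro u c hc t ht n
    simpa using norm_semigroupS_le ∞ ht (n := n) fun m _ => hc m
  refine sub_eq_zero.1 (hd ▸ ?_)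
  ext n
  set M := (∑' j, ‖cesaroNumber (-(α : ℂ)) j‖) * C * ‖cesaroNumber ((α : ℂ) + 1) n‖ + C'
  -- `D^α f` is not yet known to be bounded, so the sup norm of `d` is unavailable. Still, `S_∞(t) d
  -- = e^{zt} d` while `S_∞(t) d = D^α S_∞(t) f - S_∞(t) F` is bounded in `t` at each fixed `n`,
  -- which forces `d n = 0`.
  have h5 : ∀ t : ℝ, 0 ≤ t → Real.exp (z.re * t) * ‖d n‖ ≤ M := by
    intro t ht
    have h6 : Real.exp (z.re * t) * ‖d n‖ = ‖semigroupS ∞ t d n‖ := by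
      rw [h4 t ht, Pi.smul_apply, norm_smul, Complex.norm_exp]
      simp
    rw [h6, hd, semigroupS_sub hDtame (BoundedSeq.tame ⟨C', hC'⟩) ∞ ht,
      ← weightedWeyl_semigroupS hα ∞ ht ⟨C, hC⟩]
    exact (norm_sub_le _ _).trans (add_le_add
      (norm_weightedWeyl_le hα (hsup f C hC t ht) n) (hsup F C' hC' t ht n))
  by_contra hdn
  have h7 : Tendsto (fun t : ℝ => Real.exp (z.re * t) * ‖d n‖) atTop atTop :=
    (Real.tendsto_exp_atTop.comp (tendsto_id.const_mul_atTop hz)).atTop_mul_const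
      (norm_pos_iff.2 hdn)
  obtain ⟨t, h8, h9⟩ := ((h7.eventually_gt_atTop M).and (eventually_ge_atTop 0)).exists
  exact absurd (h5 t h9) (not_le.2 h8)

theorem exists_mem_generatorB_top {α : ℝ} (hα : 0 ≤ α) {z : ℂ} (hz : 0 < z.re) {h : ℕ → ℂ}
    (hh : h ∈ tau α ∞) : ∃ f, (f, z • f - h) ∈ generatorB α ∞ ∧
      tauNorm α ∞ f ≤ ENNReal.ofReal (z.re)⁻¹ * tauNorm α ∞ h := by
  obtain ⟨hh1, hh2⟩ := mem_tau_top_iff.1 hh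
  obtain ⟨f, hf, hfn, hft⟩ := exists_sub_genB_eq le_top hz hh1
  obtain ⟨F, hF, hFn, hFt⟩ := exists_sub_genB_eq le_top hz hh2
  set K := ‖z‖ₑ * ENNReal.ofReal (z.re)⁻¹ + 1
  have hKtop : K < ∞ := ENNReal.add_lt_top.2
    ⟨ENNReal.mul_lt_top enorm_lt_top ENNReal.ofReal_lt_top, ENNReal.one_lt_top⟩
  have hffin : seqNorm ∞ f < ∞ := hfn.trans_lt (ENNReal.mul_lt_top ENNReal.ofReal_lt_top hh1)
  have hFfin : seqNorm ∞ F < ∞ := hFn.trans_lt (ENNReal.mul_lt_top ENNReal.ofReal_lt_top hh2)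
  have hfb := BoundedSeq.of_seqNorm_lt_top le_top hffin
  have hDf : weightedWeyl α f = F := weightedWeyl_eq_of_sub_genB_eq hα hz
    (ENNReal.mul_lt_top hKtop hh1) hfb (.of_seqNorm_lt_top le_top hh1)
    (.of_seqNorm_lt_top le_top hFfin) hf hF fun t ht => seqNorm_diffQuotient_le ht (hft t ht)
  have hfm : f ∈ tau α ∞ := mem_tau_top_iff.2 ⟨hffin, by rwa [hDf]⟩
  have hgen : genB ∞ f = z • f - h := by rw [← hf]; abel
  refine ⟨f, ⟨hfm, sub_mem_tau hα le_top (smul_mem_tau hfm z) hh, fun t ht => ?_,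
    fun h => absurd rfl h, fun _ => ⟨⟨(K * tauNorm α ∞ h).toNNReal, ?_⟩, fun n => ?_⟩⟩, ?_⟩
  · rw [mem_tau_top_iff, weightedWeyl_semigroupS hα ∞ ht.le hfb, hDf]
    exact ⟨(seqNorm_semigroupS_le le_top ht.le f).trans_lt hffin,
      (seqNorm_semigroupS_le le_top ht.le F).trans_lt hFfin⟩
  · rw [ENNReal.coe_toNNReal (ENNReal.mul_lt_top hKtop hh.2).ne]
    filter_upwards [self_mem_nhdsWithin] with t (ht : 0 < t)
    rw [tauNorm_top, tauNorm_top, weightedWeyl_diffQuotient_semigroupS hα ∞ hfb ht.le, hDf]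
    exact max_le ((seqNorm_diffQuotient_le ht (hft t ht)).trans
        (mul_le_mul_right (le_max_left _ _) _))
      ((seqNorm_diffQuotient_le ht (hFt t ht)).trans (mul_le_mul_right (le_max_right _ _) _))
  · simpa only [hgen] using tendsto_diffQuotient_semigroupS ∞ hfb.tame n
  · rw [tauNorm_top, tauNorm_top, hDf]
    exact max_le (hfn.trans (mul_le_mul_right (le_max_left _ _) _))
      (hFn.trans (mul_le_mul_right (le_max_right _ _) _))

theorem exists_mem_generatorB {α : ℝ} (hα : 0 ≤ α) {p : ℝ≥0∞} (hp : 1 ≤ p) {z : ℂ}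
    (hz : 0 < z.re) {h : ℕ → ℂ} (hh : h ∈ tau α p) : ∃ f, (f, z • f - h) ∈ generatorB α p ∧
      tauNorm α p f ≤ ENNReal.ofReal (z.re)⁻¹ * tauNorm α p h := by
  by_cases hp' : p = ∞
  · subst hp'
    exact exists_mem_generatorB_top hα hz hh
  · exact exists_mem_generatorB_of_ne_top hα hp hp' hz hh

theorem eq_of_mem_generatorB {α : ℝ} (hα : 0 ≤ α) {p : ℝ≥0∞} (hp : 1 ≤ p) {z : ℂ}
    (hz : 0 < z.re) {f g h : ℕ → ℂ} (hf : (f, z • f - h) ∈ generatorB α p)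
    (hg : (g, z • g - h) ∈ generatorB α p) : f = g := by
  by_contra hfg
  refine not_le.2 hz (re_nonpos_of_seqNorm_cesaroNumber_lt_top hp
    (seqNorm_cesaroNumber_lt_top_of_mem_tau hα (sub_mem_tau hα hp hf.1 hg.1)
      (sub_ne_zero.2 hfg) ?_))
  rw [genB_sub, genB_eq_of_mem_generatorB hα hp hf, genB_eq_of_mem_generatorB hα hp hg, smul_sub]
  abel

theorem mem_resolventSet_generatorB {α : ℝ} (hα : 0 ≤ α) {p : ℝ≥0∞} (hp : 1 ≤ p) {z : ℂ}
    (hz : 0 < z.re) : z ∈ resolventSet α p (generatorB α p) := by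
  refine ⟨fun h hh => ?_, (z.re)⁻¹.toNNReal, fun f g hfg => ?_⟩
  · obtain ⟨f, hf, -⟩ := exists_mem_generatorB hα hp hz hh
    exact ⟨f, hf, fun g hg => eq_of_mem_generatorB hα hp hz hg hf⟩
  · obtain ⟨f', hf', hb⟩ := exists_mem_generatorB hα hp hz
      (sub_mem_tau hα hp (smul_mem_tau hfg.1 z) hfg.2.1)
    have h1 : f = f' := eq_of_mem_generatorB hα hp hz (h := z • f - g) (by simpa using hfg) hf'
    rw [← h1] at hb
    exact hb

/-- An eigenvector `f` for `z - ε` satisfies `(z - B)f = εf`, so a resolvent bound `C` would give `1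
≤ Cε`; this fails for `ε = 1/(C + 1)`. The imaginary axis is included since `Re (z - ε) < 0`. -/
theorem notMem_resolventSet_generatorB {α : ℝ} (hα : 0 ≤ α) {p : ℝ≥0∞} (hp : 1 ≤ p) {z : ℂ}
    (hz : z.re ≤ 0) : z ∉ resolventSet α p (generatorB α p) := by
  rintro ⟨-, C, hC⟩
  set ε : ℝ := ((C : ℝ) + 1)⁻¹ with hε
  have hε0 : 0 < ε := by positivity
  have hfin := seqNorm_cesaroNumber_lt_top hp (z := z - ε) (by simp; linarith)
  have hmem := cesaroNumber_mem_generatorB hα hp hfin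
  set f := cesaroNumber (z - ε + 1 - ((1 / p).toReal : ℂ))
  have h1 := hC _ _ hmem
  rw [← sub_smul, sub_sub_cancel, tauNorm_smul, enorm_ofReal_of_nonneg hε0.le, ← mul_assoc] at h1
  have h2 : tauNorm α p f ≠ 0 := fun h => cesaroNumber_ne_zero _ (tauNorm_eq_zero hα hp hmem.1 h)
  have h3 : tauNorm α p f ≠ ∞ := hmem.1.2.ne
  have h4 : (C : ℝ≥0∞) * ENNReal.ofReal ε < 1 := by
    rw [← ENNReal.ofReal_coe_nnreal, ← ENNReal.ofReal_mul (by positivity), ENNReal.ofReal_lt_one,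
      hε, ← div_eq_mul_inv, div_lt_one (by positivity)]
    linarith
  have h5 := ENNReal.mul_lt_mul_left h2 h3 h4
  rw [one_mul] at h5
  exact absurd h1 (not_le.2 h5)

theorem spectrumOn_generatorB {α : ℝ} (hα : 0 ≤ α) {p : ℝ≥0∞} (hp : 1 ≤ p) :
    spectrumOn α p (generatorB α p) = {z : ℂ | z.re ≤ 0} := by
  ext z
  refine ⟨fun h => not_lt.1 fun hz => h (mem_resolventSet_generatorB hα hp hz),
    fun h => notMem_resolventSet_generatorB hα hp h⟩

end SobolevLebesgue

theorem mainTheorem10 (α : ℝ) (hα : 0 ≤ α) (p : ℝ≥0∞) (hp : 1 ≤ p) :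
    (1 < p → p < ∞ →
      SobolevLebesgue.pointSpectrum (SobolevLebesgue.generatorA α p) = ∅ ∧
      SobolevLebesgue.pointSpectrum (SobolevLebesgue.generatorB α p) = {z : ℂ | z.re < 0}) ∧
    (p = 1 →
      SobolevLebesgue.pointSpectrum (SobolevLebesgue.generatorA α p) = ∅ ∧
      SobolevLebesgue.pointSpectrum (SobolevLebesgue.generatorB α p) =
        {z : ℂ | z.re < 0} ∪ {0}) ∧
    (p = ∞ →
      SobolevLebesgue.pointSpectrum (SobolevLebesgue.generatorA α p) = {0} ∧
      SobolevLebesgue.pointSpectrum (SobolevLebesgue.generatorB α p) =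
        {z : ℂ | z.re < 0} ∪ {z : ℂ | z.re = 0}) ∧
    SobolevLebesgue.spectrumOn α p (SobolevLebesgue.generatorB α p) =
      {z : ℂ | z.re < 0} ∪ {z : ℂ | z.re = 0} := by
  have hunion : {z : ℂ | z.re < 0} ∪ {z : ℂ | z.re = 0} = {z : ℂ | z.re ≤ 0} :=
    Set.ext fun _ => (le_iff_lt_or_eq (α := ℝ)).symm
  refine ⟨fun h1 htop => ⟨SobolevLebesgue.pointSpectrum_generatorA_of_ne_top hα hp htop.ne, ?_⟩,
    fun h1 => ⟨SobolevLebesgue.pointSpectrum_generatorA_of_ne_top hα hp (by simp [h1]), ?_⟩, fun htop => ?_, ?_⟩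
  · ext z
    rw [SobolevLebesgue.mem_pointSpectrum_generatorB_iff hα hp]
    refine ⟨fun h => ?_, fun h => SobolevLebesgue.seqNorm_cesaroNumber_lt_top hp h⟩
    exact (SobolevLebesgue.re_neg_of_seqNorm_cesaroNumber_lt_top hp htop.ne h).resolve_right fun h => h1.ne' h.1
  · ext z
    rw [SobolevLebesgue.mem_pointSpectrum_generatorB_iff hα hp]
    refine ⟨fun h => ?_, ?_⟩
    · exact (SobolevLebesgue.re_neg_of_seqNorm_cesaroNumber_lt_top hp (by simp [h1]) h).imp id fun h => h.2
    · rintro (h | rfl)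
      · exact SobolevLebesgue.seqNorm_cesaroNumber_lt_top hp h
      · subst h1
        exact SobolevLebesgue.seqNorm_one_cesaroNumber_lt_top
  · subst htop
    refine ⟨SobolevLebesgue.pointSpectrum_generatorA_top hα, ?_⟩
    rw [hunion]
    ext z
    rw [SobolevLebesgue.mem_pointSpectrum_generatorB_iff hα hp]
    exact ⟨fun h => SobolevLebesgue.re_nonpos_of_seqNorm_cesaroNumber_lt_top hp h,
      fun h => SobolevLebesgue.seqNorm_cesaroNumber_top_lt_top h⟩
  · rw [hunion, SobolevLebesgue.spectrumOn_generatorB hα hp]
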